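/- Let $M$ be a compact complex manifold of complex dimension $n\ge 3$ with complex structure $J$, and let $g$ be a (smooth) $J$-Hermitian metric on $M$, i.e. a Riemannian metric with $g(J\cdot,J\cdot)=g$. Let $\Omega(\cdot,\cdot)=g(J\cdot,\cdot)$ be its fundamental $2$-form and let $\theta=J*d*\Omega$ be its Lee form, where $*$ is the Hodge star operator of $g$ for the orientation given by $J$. Suppose that $g$ is $1$-st Gauduchon, i.e. $\partial\bar\partial\Omega\wedge\Omega^{n-2}=0$, and balanced, i.e. $\theta=0$. Then $g$ is Kähler, i.e. $d\Omega=0$. -/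

import Mathlib

open scoped Manifold ContDiff Bundle

noncomputable section

namespace HermitianGeometry

/-! ### Linear algebra of complex-valued real forms -/

/-- The model space `ℂⁿ`, with its Euclidean norm. -/
abbrev Cn (n : ℕ) : Type := EuclideanSpace ℂ (Fin n)

/-- Complex-valued `k`-covectors on `ℂⁿ` viewed as a real vector space, i.e. elements of
`Λᵏ(ℂⁿ)* ⊗ ℂ`. A complex-valued differential `k`-form on (an open subset of) `ℂⁿ` is a
function `Cn n → Covec n k`. -/
abbrev Covec (n k : ℕ) : Type := Cn n [⋀^Fin k]→L[ℝ] ℂ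

/-- Multiplication by `i` on `ℂⁿ` as a real-linear map: the standard complex structure. -/
def mulI (n : ℕ) : Cn n →L[ℝ] Cn n := Complex.I • ContinuousLinearMap.id ℝ (Cn n)

@[simp]
theorem mulI_apply {n : ℕ} (v : Cn n) : mulI n v = Complex.I • v := rfl

theorem mulI_mulI {n : ℕ} (v : Cn n) : mulI n (mulI n v) = -v := by
  rw [mulI_apply, mulI_apply, smul_smul, Complex.I_mul_I, neg_one_smul]

/-- The wedge product, with the usual normalisation
`(α ∧ β)(v₁, …, v_{p+q}) = ∑ sign(σ) α(v_{σ 1}, …, v_{σ p}) β(v_{σ (p+1)}, …, v_{σ (p+q)})`,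
the sum being over `(p, q)`-shuffles `σ`. -/
def wedge {n p q : ℕ} (α : Covec n p) (β : Covec n q) : Covec n (p + q) where
  toAlternatingMap := ((LinearMap.mul' ℝ ℂ).compAlternatingMap
    (α.toAlternatingMap.domCoprod β.toAlternatingMap)).domDomCongr finSumFinEquiv
  cont := by
    change Continuous fun v : Fin (p + q) → Cn n => LinearMap.mul' ℝ ℂ
      ((α.toAlternatingMap.domCoprod β.toAlternatingMap) fun i => v (finSumFinEquiv i))
    simp only [AlternatingMap.domCoprod_apply, _root_.sum_apply, map_sum]
    refine continuous_finsetSum _ fun σ _ => ?_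
    induction σ using Quotient.inductionOn' with
    | h σ =>
      simp only [AlternatingMap.domCoprod.summand_mk'', _root_.smul_apply,
        MultilinearMap.domDomCongr_apply, MultilinearMap.domCoprod_apply,
        LinearMap.map_smul_of_tower, LinearMap.mul'_apply]
      refine Continuous.const_smul (Continuous.mul ?_ ?_) _
      · exact α.cont.comp (by fun_prop)
      · exact β.cont.comp (by fun_prop)

/-- The powers `Ωᵏ = Ω ∧ ⋯ ∧ Ω` of a `2`-covector. -/
def wedgePow {n : ℕ} (Ω : Covec n 2) : (k : ℕ) → Covec n (2 * k)
  | 0 => ContinuousAlternatingMap.constOfIsEmpty ℝ (Cn n) (Fin 0) 1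
  | k + 1 => wedge (wedgePow Ω k) Ω

/-- For a bilinear form `h` and vectors `v₁, …, v_m`, the covector `v₁♭ ∧ ⋯ ∧ v_m♭`, where
`v♭ = h(v, ·)`; explicitly `(v₁♭ ∧ ⋯ ∧ v_m♭)(w₁, …, w_m) = det (h(vᵢ, wⱼ))`. -/
def flatWedge {n m : ℕ} (h : Cn n →L[ℝ] Cn n →L[ℝ] ℝ) (v : Fin m → Cn n) : Covec n m where
  toAlternatingMap := Complex.ofRealAm.toLinearMap.compAlternatingMap
    ((Matrix.detRowAlternating (R := ℝ) (n := Fin m)).compLinearMap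
      (LinearMap.pi fun i => (h (v i)).toLinearMap))
  cont := by
    change Continuous fun w : Fin m → Cn n =>
      ((Matrix.det (Matrix.of fun j i => h (v i) (w j)) : ℝ) : ℂ)
    refine Complex.continuous_ofReal.comp (Continuous.matrix_det ?_)
    fun_prop

theorem flatWedge_apply {n m : ℕ} (h : Cn n →L[ℝ] Cn n →L[ℝ] ℝ) (v w : Fin m → Cn n) :
    flatWedge h v w = ((Matrix.det (Matrix.of fun i j => h (v i) (w j)) : ℝ) : ℂ) := by
  rw [← Matrix.det_transpose]
  rfl

theorem wedge_apply_eq_sum {n p q : ℕ} (α : Covec n p) (β : Covec n q)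
    (v : Fin (p + q) → Cn n) :
    wedge α β v = ∑ σ : Equiv.Perm.ModSumCongr (Fin p) (Fin q), LinearMap.mul' ℝ ℂ
      (AlternatingMap.domCoprod.summand α.toAlternatingMap β.toAlternatingMap σ
        fun i => v (finSumFinEquiv i)) := by
  change LinearMap.mul' ℝ ℂ
    ((α.toAlternatingMap.domCoprod β.toAlternatingMap) fun i => v (finSumFinEquiv i)) = _
  simp only [AlternatingMap.domCoprod_apply, _root_.sum_apply, map_sum]

/-- `v ↦ v₁♭ ∧ ⋯ ∧ v_m♭` is alternating in `v`. -/
def flatWedgeAlt {n : ℕ} (m : ℕ) (h : Cn n →L[ℝ] Cn n →L[ℝ] ℝ) :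
    Cn n [⋀^Fin m]→ₗ[ℝ] Covec n m where
  toFun v := flatWedge h v
  map_update_add' := by
    intro inst v i x y
    obtain rfl : inst = instDecidableEqFin m := Subsingleton.elim _ _
    ext w
    rw [ContinuousAlternatingMap.add_apply]
    simp only [flatWedge_apply]
    rw [← Complex.ofReal_add]
    exact congrArg _ (((Matrix.detRowAlternating (R := ℝ) (n := Fin m)).compLinearMap
      (LinearMap.pi fun j => (h.flip (w j)).toLinearMap)).map_update_add v i x y)
  map_update_smul' := by
    intro inst v i c x
    obtain rfl : inst = instDecidableEqFin m := Subsingleton.elim _ _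
    ext w
    rw [ContinuousAlternatingMap.smul_apply]
    simp only [flatWedge_apply]
    rw [Complex.real_smul, ← Complex.ofReal_mul]
    exact congrArg _ (((Matrix.detRowAlternating (R := ℝ) (n := Fin m)).compLinearMap
      (LinearMap.pi fun j => (h.flip (w j)).toLinearMap)).map_update_smul v i c x)
  map_eq_zero_of_eq' v i j hv hij := by
    ext w
    rw [flatWedge_apply]
    exact (congrArg (fun t : ℝ => (t : ℂ))
      (((Matrix.detRowAlternating (R := ℝ) (n := Fin m)).compLinearMap
      (LinearMap.pi fun j => (h.flip (w j)).toLinearMap)).map_eq_zero_of_eq v hv hij)).trans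
      Complex.ofReal_zero

/-- `β ↦ α ∧ β` as a real-linear map. -/
def wedgeLeft {n p : ℕ} (q : ℕ) (α : Covec n p) : Covec n q →ₗ[ℝ] Covec n (p + q) where
  toFun β := wedge α β
  map_add' β γ := by
    ext v
    exact (congrArg (fun f => LinearMap.mul' ℝ ℂ (f fun i => v (finSumFinEquiv i)))
      (map_add (AlternatingMap.domCoprod' ∘ₗ TensorProduct.mk ℝ _ _ α.toAlternatingMap)
        β.toAlternatingMap γ.toAlternatingMap)).trans (map_add (LinearMap.mul' ℝ ℂ) _ _)
  map_smul' c β := by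
    ext v
    exact (congrArg (fun f => LinearMap.mul' ℝ ℂ (f fun i => v (finSumFinEquiv i)))
      (map_smul (AlternatingMap.domCoprod' ∘ₗ TensorProduct.mk ℝ _ _ α.toAlternatingMap)
        c β.toAlternatingMap)).trans (map_smul (LinearMap.mul' ℝ ℂ) _ _)

/-- Evaluation of covectors at fixed vectors, as a real-linear map. -/
def evalAt {n k : ℕ} (b : Fin k → Cn n) : Covec n k →ₗ[ℝ] ℂ where
  toFun α := α b
  map_add' _ _ := rfl
  map_smul' _ _ := rfl

/-- The real basis `(e₁, i e₁, …, e_n, i e_n)` of `ℂⁿ`, which is positive for the orientation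
given by the complex structure. -/
def realFrame (n : ℕ) (j : Fin (2 * n)) : Cn n :=
  Complex.I ^ (j.val % 2) • EuclideanSpace.single (⟨j.val / 2, by omega⟩ : Fin n) (1 : ℂ)

/-- The Hodge star operator of a real inner product `h` on `ℂⁿ` (with its complex orientation)
on `k`-covectors, `k + m = 2 n`: the `m`-covector `⋆α` is determined by
`α ∧ v₁♭ ∧ ⋯ ∧ v_m♭ = (⋆α)(v₁, …, v_m) vol_h`, where both sides are compared on the positive
basis `b = realFrame n`, for which `vol_h(b₁, …, b_{2n}) = √(det (h(bᵢ, bⱼ)))`. This is the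
operator with `α ∧ ⋆β = ⟨α, β⟩ vol_h` for real `α`, `β`, extended complex linearly. -/
def hodgeStar {n k m : ℕ} (hkm : k + m = 2 * n) (h : Cn n →L[ℝ] Cn n →L[ℝ] ℝ)
    (α : Covec n k) : Covec n m where
  toAlternatingMap :=
    ((Real.sqrt (Matrix.det (Matrix.of fun i j => h (realFrame n i) (realFrame n j))))⁻¹ •
      (evalAt (fun i => realFrame n (Fin.cast hkm i)) ∘ₗ wedgeLeft m α)).compAlternatingMap
        (flatWedgeAlt m h)
  cont := by
    have hc : Continuous fun v : Fin m → Cn n =>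
        wedge α (flatWedge h v) fun i => realFrame n (Fin.cast hkm i) := by
      simp only [wedge_apply_eq_sum]
      refine continuous_finsetSum _ fun σ _ => ?_
      induction σ using Quotient.inductionOn' with
      | h σ =>
        simp only [AlternatingMap.domCoprod.summand_mk'', _root_.smul_apply,
          MultilinearMap.domDomCongr_apply, MultilinearMap.domCoprod_apply,
          LinearMap.map_smul_of_tower, LinearMap.mul'_apply]
        refine Continuous.const_smul (Continuous.mul continuous_const ?_) _
        change Continuous fun v => flatWedge h v _
        simp only [flatWedge_apply]
        refine Complex.continuous_ofReal.comp (Continuous.matrix_det ?_)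
        fun_prop
    exact hc.const_smul
      (Real.sqrt (Matrix.det (Matrix.of fun i j => h (realFrame n i) (realFrame n j))))⁻¹

theorem hodgeStar_apply {n k m : ℕ} (hkm : k + m = 2 * n) (h : Cn n →L[ℝ] Cn n →L[ℝ] ℝ)
    (α : Covec n k) (v : Fin m → Cn n) :
    hodgeStar hkm h α v =
      (Real.sqrt (Matrix.det (Matrix.of fun i j => h (realFrame n i) (realFrame n j))))⁻¹ •
        wedge α (flatWedge h v) (fun i => realFrame n (Fin.cast hkm i)) := rfl

/-- The action of `J` on covectors; on `1`-covectors `(Jα)(v) = α(i v)`. -/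
def covecJ {n k : ℕ} (α : Covec n k) : Covec n k := α.compContinuousLinearMap (mulI n)

/-! ### The operators `∂` and `∂̄` on open sets of `ℂⁿ` -/

/-- The complex-linear part `v ↦ ½ (A v - i A (i v))` of a real-linear map. -/
def linPart {n k : ℕ} (A : Cn n →L[ℝ] Covec n k) : Cn n →L[ℝ] Covec n k :=
  (1 / 2 : ℂ) • (A - Complex.I • A.comp (mulI n))

/-- The complex-antilinear part `v ↦ ½ (A v + i A (i v))` of a real-linear map. -/
def antilinPart {n k : ℕ} (A : Cn n →L[ℝ] Covec n k) : Cn n →L[ℝ] Covec n k :=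
  (1 / 2 : ℂ) • (A + Complex.I • A.comp (mulI n))

/-- The operator `∂` on complex-valued `k`-forms on `ℂⁿ`: `∂α = ∑ⱼ dzⱼ ∧ ∂α/∂zⱼ`, where the
Wirtinger derivative `∂/∂zⱼ` is applied to the coefficients of `α`. Here `∑ⱼ dzⱼ ⊗ ∂α/∂zⱼ` is the
complex-linear part of the total derivative of `α`. It maps `(p, q)`-forms to
`(p + 1, q)`-forms. -/
def del {n k : ℕ} (α : Cn n → Covec n k) (z : Cn n) : Covec n (k + 1) :=
  .alternatizeUncurryFin (linPart (fderiv ℝ α z))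

/-- The operator `∂̄` on complex-valued `k`-forms on `ℂⁿ`: `∂̄α = ∑ⱼ dz̄ⱼ ∧ ∂α/∂z̄ⱼ`. It maps
`(p, q)`-forms to `(p, q + 1)`-forms. -/
def delbar {n k : ℕ} (α : Cn n → Covec n k) (z : Cn n) : Covec n (k + 1) :=
  .alternatizeUncurryFin (antilinPart (fderiv ℝ α z))

/-- The exterior derivative is `d = ∂ + ∂̄`. -/
theorem extDeriv_eq_del_add_delbar {n k : ℕ} (α : Cn n → Covec n k) (z : Cn n) :
    extDeriv α z = del α z + delbar α z := by
  rw [del, delbar, ← ContinuousAlternatingMap.alternatizeUncurryFin_add, extDeriv]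
  congr 1
  ext v w
  simp [linPart, antilinPart]
  ring

/-! ### Hermitian metrics on complex manifolds

Differential forms on a complex manifold are differentiated through their coordinate expressions
in the holomorphic charts of the atlas: an identity between forms holds on `M` if and only if its
coordinate expression holds at every point of every chart. -/

/-- A complex manifold is in particular a smooth (even real-analytic) manifold. -/
instance isManifold_real {n : ℕ} {M : Type*} [TopologicalSpace M] [ChartedSpace (Cn n) M]
    [IsManifold 𝓘(ℂ, Cn n) ω M] : IsManifold 𝓘(ℝ, Cn n) ω M := by
  refine isManifold_of_contDiffOn _ _ _ fun e e' he he' => ?_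
  have := (contDiffGroupoid ω 𝓘(ℂ, Cn n)).compatible he he'
  rw [contDiffGroupoid, mem_groupoid_of_pregroupoid] at this
  exact ContDiffOn.restrict_scalars ℝ this.1

section Manifold

variable {n : ℕ} {M : Type*} [TopologicalSpace M] [ChartedSpace (Cn n) M]

/-- The complex structure `J` of the real tangent space `T_pM`: the model `ℂⁿ` of `T_pM` is
identified with `T_pM` through the preferred holomorphic chart at `p`, and `J` is multiplication by `i`. -/
def tangentJ (p : M) : TangentSpace 𝓘(ℝ, Cn n) p →L[ℝ] TangentSpace 𝓘(ℝ, Cn n) p := mulI n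

variable (n M) in
/-- A (smooth) `J`-Hermitian metric on a complex manifold: a Riemannian metric `g` with
`g(Jv, Jw) = g(v, w)`. -/
structure HermitianMetric [IsManifold 𝓘(ℂ, Cn n) ω M] extends
    Bundle.ContMDiffRiemannianMetric 𝓘(ℝ, Cn n) ∞ (Cn n)
      (fun p : M => TangentSpace 𝓘(ℝ, Cn n) p) where
  inner_J : ∀ (p : M) (v w : TangentSpace 𝓘(ℝ, Cn n) p),
    inner p (tangentJ p v) (tangentJ p w) = inner p v w

namespace HermitianMetric

variable [IsManifold 𝓘(ℂ, Cn n) ω M]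

/-- The fundamental `2`-form `Ω(v, w) = g(Jv, w)` at a point. -/
def fundamentalForm (g : HermitianMetric n M) (p : M) :
    TangentSpace 𝓘(ℝ, Cn n) p [⋀^Fin 2]→L[ℝ] ℂ where
  toFun v := (g.inner p (tangentJ p (v 0)) (v 1) : ℂ)
  map_update_add' v i x y := by
    fin_cases i <;> simp [Function.update]
  map_update_smul' v i c x := by
    fin_cases i <;> simp [Function.update]
  map_eq_zero_of_eq' v i j hv hij := by
    have key : ∀ u : TangentSpace 𝓘(ℝ, Cn n) p, g.inner p (tangentJ p u) u = 0 := fun u => by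
      have h1 := g.inner_J p (tangentJ p u) u
      have h2 : tangentJ p (tangentJ p u) = -u := mulI_mulI (n := n) u
      rw [h2, map_neg, _root_.neg_apply, g.symm] at h1
      linarith
    have h01 : v 0 = v 1 := by
      fin_cases i <;> fin_cases j <;> simp_all
    rw [h01, key, Complex.ofReal_zero]
  cont := by
    change Continuous fun v : Fin 2 → Cn n =>
      (((show Cn n →L[ℝ] Cn n →L[ℝ] ℝ from g.inner p) (mulI n (v 0)) (v 1) : ℝ) : ℂ)
    fun_prop

/-- The real differential at `z` of the inverse of a chart `e : M ⊇ U → ℂⁿ`, i.e. the coordinate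
frame `ℂⁿ → T_pM`, `p = e⁻¹(z)`. -/
def chartFrame (e : OpenPartialHomeomorph M (Cn n)) (z : Cn n) :
    Cn n →L[ℝ] TangentSpace 𝓘(ℝ, Cn n) (e.symm z) :=
  mfderiv 𝓘(ℝ, Cn n) 𝓘(ℝ, Cn n) e.symm z

/-- The coordinate expression of the metric in a chart. -/
def inChart (g : HermitianMetric n M) (e : OpenPartialHomeomorph M (Cn n)) (z : Cn n) :
    Cn n →L[ℝ] Cn n →L[ℝ] ℝ :=
  ContinuousLinearMap.bilinearComp (E' := Cn n) (F' := Cn n)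
    (show Cn n →L[ℝ] Cn n →L[ℝ] ℝ from g.inner (e.symm z)) (chartFrame e z) (chartFrame e z)

/-- The coordinate expression of the fundamental form in a chart. -/
def fundamentalFormInChart (g : HermitianMetric n M) (e : OpenPartialHomeomorph M (Cn n))
    (z : Cn n) : Covec n 2 :=
  (g.fundamentalForm (e.symm z)).compContinuousLinearMap (chartFrame e z)

/-- `g` is Kähler if `dΩ = 0`. -/
def IsKahler (g : HermitianMetric n M) : Prop :=
  ∀ e ∈ atlas (Cn n) M, ∀ z ∈ e.target, extDeriv (g.fundamentalFormInChart e) z = 0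

/-- `g` is `1`-st Gauduchon if `∂∂̄Ω ∧ Ωⁿ⁻² = 0` (for `n ≥ 2`). -/
def IsFirstGauduchon (g : HermitianMetric n M) : Prop :=
  ∀ e ∈ atlas (Cn n) M, ∀ z ∈ e.target,
    wedge (del (delbar (g.fundamentalFormInChart e)) z)
      (wedgePow (g.fundamentalFormInChart e z) (n - 2)) = 0

/-- The Lee form `θ = J ⋆ d ⋆ Ω` in a chart (in complex dimension `n ≥ 1`). -/
def leeFormInChart (g : HermitianMetric n M) (hn : 1 ≤ n)
    (e : OpenPartialHomeomorph M (Cn n)) (z : Cn n) : Covec n 1 :=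
  covecJ (hodgeStar (k := 2 * n - 2 + 1) (m := 1) (by omega) (g.inChart e z)
    (extDeriv (fun w => hodgeStar (k := 2) (m := 2 * n - 2) (by omega) (g.inChart e w)
      (g.fundamentalFormInChart e w)) z))

/-- `g` is balanced if its Lee form vanishes. -/
def IsBalanced (g : HermitianMetric n M) (hn : 1 ≤ n) : Prop :=
  ∀ e ∈ atlas (Cn n) M, ∀ z ∈ e.target, g.leeFormInChart hn e z = 0

end HermitianMetric

end Manifold

end HermitianGeometry

end

/-! The statement is local, so one works in a holomorphic chart around a point `z`, with metric `h`
and a real basis `F = (e₁, i e₁, …)` that is orthonormal for `h z` and is then kept constant. Put `A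
p q = h (F p) (F q)`; lower indices `∂` denote derivatives along `F`.

Balanced: since `J` and the star on degree `2n - 1` are injective, `θ = 0` means `d⋆Ω = 0`. In the
constant frame `⋆Ω` is, up to a nonzero constant, the contraction of a constant volume form with the
bivector `√(det A) A⁻¹ Jᵀ`. So `d⋆Ω = 0` says that this bivector is divergence free. As `J` is
constant in holomorphic coordinates it drops out, leaving `∑_q ∂_q (√(det A) A^{qp}) = 0`, which is
equivalent to `A^{pq} (∂_w A_pq - 2 ∂_p A_qw) = 0` (`trace_eq_of_extDeriv_hodgeStar`). This holds
near `z`. Differentiating it along `F w` at `z`, where `A = 1`, and summing over `w` gives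
(`deriv_trace_balanced`) `∑ (∂_w ∂_w A_pp - 2 ∂_w ∂_p A_pw) = ∑ ∂_w A_pq (∂_w A_pq - 2 ∂_p A_qw)`.

First Gauduchon: wedging a `4`-form with `Ωⁿ⁻²` computes its double trace over complex lines
(`sum_eq_zero_of_wedge_wedgePow`), and for `∂∂̄Ω` that trace is a nonzero multiple of the left side
(`double_trace_eq_zero`). So the left side vanishes.

The right side is a positive multiple of `|dΩ|²`: by `J`-invariance, three times it is the sum of
the squares of the components of `dΩ` (`cyclic_sum_eq_zero`). Hence `dΩ = 0` at `z`. -/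

noncomputable section

namespace HermitianGeometry

open scoped Topology

/-! ### The metric in a holomorphic chart: smoothness, positivity, `J`-invariance. -/

section Charts

variable {n : ℕ} {M : Type*} [TopologicalSpace M] [ChartedSpace (Cn n) M]

theorem hasMFDerivAt_restrictScalars {f : Cn n → M} {z : Cn n} {f' : Cn n →L[ℂ] Cn n}
    (hf : HasMFDerivAt 𝓘(ℂ, Cn n) 𝓘(ℂ, Cn n) f z f') :
    HasMFDerivAt 𝓘(ℝ, Cn n) 𝓘(ℝ, Cn n) f z (f'.restrictScalars ℝ) :=
  ⟨hf.1, hf.2.restrictScalars ℝ⟩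

variable [IsManifold 𝓘(ℂ, Cn n) ω M]

/-- The inverse chart is holomorphic, so its real differential is the underlying real map of a
complex-linear one. Consequently `J` has constant coefficients in every chart, which the whole
computation relies on. -/
theorem chartFrame_mulI {e : OpenPartialHomeomorph M (Cn n)} (he : e ∈ atlas (Cn n) M)
    {z : Cn n} (hz : z ∈ e.target) (v : Cn n) :
    HermitianMetric.chartFrame e z (mulI n v) =
      tangentJ (e.symm z) (HermitianMetric.chartFrame e z v) := by
  have h1 : ContMDiffAt 𝓘(ℂ, Cn n) 𝓘(ℂ, Cn n) ω e.symm z :=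
    (contMDiffOn_symm_of_mem_maximalAtlas
      (IsManifold.subset_maximalAtlas (I := 𝓘(ℂ, Cn n)) (n := ω) he)).contMDiffAt
      (e.open_target.mem_nhds hz)
  have h2 := (h1.mdifferentiableAt (by simp)).hasMFDerivAt
  have h3 := (hasMFDerivAt_restrictScalars h2).mfderiv
  rw [HermitianMetric.chartFrame, h3]
  exact map_smul (show Cn n →L[ℂ] Cn n from mfderiv 𝓘(ℂ, Cn n) 𝓘(ℂ, Cn n) e.symm z) Complex.I v

theorem contMDiffOn_chart_symm {e : OpenPartialHomeomorph M (Cn n)} (he : e ∈ atlas (Cn n) M) :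
    ContMDiffOn 𝓘(ℝ, Cn n) 𝓘(ℝ, Cn n) ω e.symm e.target :=
  contMDiffOn_symm_of_mem_maximalAtlas
    (IsManifold.subset_maximalAtlas (I := 𝓘(ℝ, Cn n)) (n := ω) he)

theorem chartFrame_injective {e : OpenPartialHomeomorph M (Cn n)} (he : e ∈ atlas (Cn n) M)
    {z : Cn n} (hz : z ∈ e.target) :
    Function.Injective (HermitianMetric.chartFrame e z) := by
  have h1 : MDifferentiableAt 𝓘(ℝ, Cn n) 𝓘(ℝ, Cn n) e.symm z :=
    ((contMDiffOn_chart_symm he).contMDiffAt (e.open_target.mem_nhds hz)).mdifferentiableAt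
      (by simp)
  have h2 : MDifferentiableAt 𝓘(ℝ, Cn n) 𝓘(ℝ, Cn n) e (e.symm z) :=
    ((contMDiffOn_of_mem_maximalAtlas
      (IsManifold.subset_maximalAtlas (I := 𝓘(ℝ, Cn n)) (n := ω) he)).contMDiffAt
      (e.open_source.mem_nhds (e.map_target hz))).mdifferentiableAt (by simp)
  have h3 := h2.hasMFDerivAt.comp z h1.hasMFDerivAt
  have h4 : HasMFDerivAt 𝓘(ℝ, Cn n) 𝓘(ℝ, Cn n) (e ∘ e.symm) z
      (ContinuousLinearMap.id ℝ (TangentSpace 𝓘(ℝ, Cn n) z)) :=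
    (hasMFDerivAt_id z).congr_of_eventuallyEq
      (Filter.eventuallyEq_of_mem (e.open_target.mem_nhds hz) fun y hy => e.right_inv hy)
  have h5 := hasMFDerivAt_unique h3 h4
  intro v w hvw
  have h6 := fun u : Cn n => congrArg (fun f : Cn n →L[ℝ] Cn n => f u) h5
  have hv := h6 v
  have hw := h6 w
  change (mfderiv 𝓘(ℝ, Cn n) 𝓘(ℝ, Cn n) e (e.symm z)) (HermitianMetric.chartFrame e z v) = v at hv
  change (mfderiv 𝓘(ℝ, Cn n) 𝓘(ℝ, Cn n) e (e.symm z)) (HermitianMetric.chartFrame e z w) = w at hw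
  rw [← hv, ← hw, hvw]

namespace HermitianMetric

variable (g : HermitianMetric n M) {e : OpenPartialHomeomorph M (Cn n)}

theorem inChart_apply (z v w : Cn n) :
    g.inChart e z v w = g.inner (e.symm z) (chartFrame e z v) (chartFrame e z w) := rfl

theorem inChart_symm (z v w : Cn n) : g.inChart e z v w = g.inChart e z w v :=
  g.symm _ _ _

theorem inChart_pos (he : e ∈ atlas (Cn n) M) {z : Cn n} (hz : z ∈ e.target) {v : Cn n}
    (hv : v ≠ 0) : 0 < g.inChart e z v v := by
  refine g.pos _ _ fun h => hv (chartFrame_injective he hz ?_)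
  exact h.trans (map_zero (chartFrame e z)).symm

theorem inChart_mulI (he : e ∈ atlas (Cn n) M) {z : Cn n} (hz : z ∈ e.target) (v w : Cn n) :
    g.inChart e z (mulI n v) (mulI n w) = g.inChart e z v w := by
  rw [inChart_apply, chartFrame_mulI he hz, chartFrame_mulI he hz, g.inner_J]
  rfl

theorem fundamentalFormInChart_apply (he : e ∈ atlas (Cn n) M) {z : Cn n} (hz : z ∈ e.target)
    (v : Fin 2 → Cn n) :
    g.fundamentalFormInChart e z v = (g.inChart e z (mulI n (v 0)) (v 1) : ℂ) := by
  rw [inChart_apply, chartFrame_mulI he hz]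
  rfl

/-- The images of constant vectors under the differential of `e.symm` are smooth sections of the
tangent bundle along `e.symm`, and the coefficients of the metric are its pairings with them. -/
theorem contDiffOn_inChart (he : e ∈ atlas (Cn n) M) :
    ContDiffOn ℝ ∞ (g.inChart e) e.target := by
  refine contDiffOn_clm_apply.2 fun v => contDiffOn_clm_apply.2 fun w => ?_
  have hv : ∀ v : Cn n, ContMDiffOn 𝓘(ℝ, Cn n) (𝓘(ℝ, Cn n).prod 𝓘(ℝ, Cn n)) ∞
      (fun z => (⟨e.symm z, chartFrame e z v⟩ : Bundle.TotalSpace (Cn n)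
        (fun p : M => TangentSpace 𝓘(ℝ, Cn n) p))) e.target := by
    intro v
    have h1 := ((contMDiffOn_chart_symm he).contMDiffOn_tangentMapWithin (m := ∞) (by simp)
      e.open_target.uniqueMDiffOn)
    have h2 : ContMDiffOn 𝓘(ℝ, Cn n) (𝓘(ℝ, Cn n).prod 𝓘(ℝ, Cn n)) ∞
        (fun z => (⟨z, v⟩ : TangentBundle 𝓘(ℝ, Cn n) (Cn n))) e.target := by
      intro z hz
      rw [Bundle.contMDiffWithinAt_totalSpace]
      refine ⟨contMDiffWithinAt_id, ?_⟩
      simpa using contMDiffWithinAt_const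
    refine (h1.comp h2 fun z hz => hz).congr fun z hz => ?_
    simp only [Function.comp_apply, tangentMapWithin, chartFrame,
      mfderivWithin_of_isOpen e.open_target hz]
    rfl
  have := ContMDiffOn.clm_bundle_apply₂ (F₁ := Cn n) (F₂ := Cn n) (F₃ := ℝ)
    (E₁ := fun p : M => TangentSpace 𝓘(ℝ, Cn n) p) (E₂ := fun p : M => TangentSpace 𝓘(ℝ, Cn n) p)
    (E₃ := Bundle.Trivial M ℝ) (ψ := fun z => g.inner (e.symm z))
    (g.contMDiff.comp_contMDiffOn ((contMDiffOn_chart_symm he).of_le (by simp))) (hv v) (hv w)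
  have h2 : ContMDiffOn 𝓘(ℝ, Cn n) 𝓘(ℝ) ∞ (fun z => g.inChart e z v w) e.target := by
    intro z hz
    have := this z hz
    simp only [Bundle.contMDiffWithinAt_totalSpace] at this
    exact this.2
  exact h2.contDiffOn

end HermitianMetric
end Charts

/-! ### Wedge products of covectors and top-degree forms. -/

section WedgeAlgebra

variable {n p q : ℕ}

theorem append_comp_finSumFinEquiv {α : Type*} (x : Fin p → α) (y : Fin q → α) :
    (fun i => Fin.append x y (finSumFinEquiv i)) = Sum.elim x y := by
  funext i
  rcases i with i | i <;> simp

/-- If `β` vanishes as soon as one of its arguments is one of the `x j`, then only the trivial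
shuffle contributes to `(α ∧ β)(x, y)`. -/
theorem wedge_append (α : Covec n p) (β : Covec n q) (x : Fin p → Cn n) (y : Fin q → Cn n)
    (hβ : ∀ w : Fin q → Cn n, (∃ i j, w i = x j) → β w = 0) :
    wedge α β (Fin.append x y) = α x * β y := by
  rw [wedge_apply_eq_sum, append_comp_finSumFinEquiv]
  refine (Finset.sum_eq_single
    (Quotient.mk'' (1 : Equiv.Perm (Fin p ⊕ Fin q)) : Equiv.Perm.ModSumCongr _ _) ?_ ?_).trans ?_
  · intro σ _ hσ
    induction σ using Quotient.inductionOn' with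
    | h σ =>
      -- A permutation outside the trivial class cannot preserve the two blocks, so it feeds some `x
      -- j` to `β`, and its summand vanishes.
      have : ∃ i j, σ (Sum.inr i) = Sum.inl j := by
        by_contra! hcon
        apply hσ
        refine Quotient.sound' ?_
        rw [QuotientGroup.leftRel_apply, mul_one]
        refine Equiv.Perm.mem_sumCongrHom_range_of_perm_mapsTo_inl ?_
        rintro _ ⟨j, rfl⟩
        rcases hs : σ⁻¹ (Sum.inl j) with i | i
        · exact ⟨i, rfl⟩
        · exact absurd (by rw [← hs]; exact σ.apply_symm_apply _) (hcon i j)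
      obtain ⟨i, j, hij⟩ := this
      rw [AlternatingMap.domCoprod.summand_mk'']
      simp only [_root_.smul_apply,
        MultilinearMap.domDomCongr_apply, MultilinearMap.domCoprod_apply,
        LinearMap.map_smul_of_tower, LinearMap.mul'_apply]
      have := hβ (fun k => Sum.elim x y (σ (Sum.inr k))) ⟨i, j, by simp [hij]⟩
      change _ • (_ * β (fun k => Sum.elim x y (σ (Sum.inr k)))) = 0
      rw [this, mul_zero, smul_zero]
  · simp
  · rw [AlternatingMap.domCoprod.summand_mk'']
    simp [MultilinearMap.domCoprod_apply]

/-- `α ↦ α ∧ β` as a real-linear map. -/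
def wedgeRight (p : ℕ) (β : Covec n q) : Covec n p →ₗ[ℝ] Covec n (p + q) where
  toFun α := wedge α β
  map_add' α γ := by
    ext v
    exact (congrArg (fun f => LinearMap.mul' ℝ ℂ (f fun i => v (finSumFinEquiv i)))
      (map_add (AlternatingMap.domCoprod' ∘ₗ (TensorProduct.mk ℝ _ _).flip β.toAlternatingMap)
        α.toAlternatingMap γ.toAlternatingMap)).trans (map_add (LinearMap.mul' ℝ ℂ) _ _)
  map_smul' c α := by
    ext v
    exact (congrArg (fun f => LinearMap.mul' ℝ ℂ (f fun i => v (finSumFinEquiv i)))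
      (map_smul (AlternatingMap.domCoprod' ∘ₗ (TensorProduct.mk ℝ _ _).flip β.toAlternatingMap)
        c α.toAlternatingMap)).trans (map_smul (LinearMap.mul' ℝ ℂ) _ _)

/-- The tensor product `v₁♭ ⊗ ⋯ ⊗ v_m♭`. -/
def flatTensor {m : ℕ} (h : Cn n →L[ℝ] Cn n →L[ℝ] ℝ) (v : Fin m → Cn n) :
    MultilinearMap ℝ (fun _ : Fin m => Cn n) ℂ :=
  (MultilinearMap.mkPiAlgebra ℝ (Fin m) ℂ).compLinearMap
    fun i => Complex.ofRealAm.toLinearMap ∘ₗ (h (v i)).toLinearMap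

theorem flatTensor_apply {m : ℕ} (h : Cn n →L[ℝ] Cn n →L[ℝ] ℝ) (v w : Fin m → Cn n) :
    flatTensor h v w = ∏ i, (h (v i) (w i) : ℂ) := rfl

theorem flatWedge_toAlternatingMap {m : ℕ} (h : Cn n →L[ℝ] Cn n →L[ℝ] ℝ) (v : Fin m → Cn n) :
    (flatWedge h v).toAlternatingMap = MultilinearMap.alternatization (flatTensor h v) := by
  ext w
  rw [MultilinearMap.alternatization_apply]
  change flatWedge h v w = _
  rw [flatWedge_apply, ← Matrix.det_transpose, Matrix.det_apply]
  push_cast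
  refine Finset.sum_congr rfl fun σ _ => ?_
  rw [MultilinearMap.domDomCongr_apply, flatTensor_apply]
  simp [Units.smul_def]

/-- Both factors are alternatizations of tensor products of `1`-forms, and the shuffle product of
two alternatizations is the alternatization of the tensor product. -/
theorem flatWedge_wedge_flatWedge (h : Cn n →L[ℝ] Cn n →L[ℝ] ℝ) (v : Fin p → Cn n)
    (w : Fin q → Cn n) :
    wedge (flatWedge h v) (flatWedge h w) = flatWedge h (Fin.append v w) := by
  ext x
  change LinearMap.mul' ℝ ℂ (((flatWedge h v).toAlternatingMap.domCoprod
    (flatWedge h w).toAlternatingMap) fun i => x (finSumFinEquiv i)) =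
      (flatWedge h (Fin.append v w)).toAlternatingMap x
  rw [flatWedge_toAlternatingMap, flatWedge_toAlternatingMap, flatWedge_toAlternatingMap,
    ← MultilinearMap.domCoprod_alternization, MultilinearMap.alternatization_apply,
    MultilinearMap.alternatization_apply, map_sum,
    ← (Equiv.permCongr (finSumFinEquiv (m := p) (n := q))).sum_comp]
  refine Finset.sum_congr rfl fun σ _ => ?_
  rw [Equiv.Perm.sign_permCongr, LinearMap.map_smul_of_tower, MultilinearMap.domDomCongr_apply,
    MultilinearMap.domDomCongr_apply, MultilinearMap.domCoprod_apply, LinearMap.mul'_apply,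
    flatTensor_apply, flatTensor_apply, flatTensor_apply, Fin.prod_univ_add]
  simp [Equiv.permCongr_apply]

/-- The positive real frame `(e₁, i e₁, …, e_n, i e_n)` as a basis. -/
def realBasis (n : ℕ) : Module.Basis (Fin (2 * n)) ℝ (Cn n) :=
  (Complex.basisOneI.smulTower (EuclideanSpace.basisFun (Fin n) ℂ).toBasis).reindex
    ((Equiv.prodComm _ _).trans (finProdFinEquiv.trans (finCongr (mul_comm n 2))))

theorem coe_realBasis (n : ℕ) : ⇑(realBasis n) = realFrame n := by
  funext j
  obtain ⟨⟨k, s⟩, rfl⟩ := (finProdFinEquiv.trans (finCongr (mul_comm n 2))).surjective j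
  have h1 : ((s : ℕ) + 2 * k) % 2 = s := by omega
  have h2 : ((s : ℕ) + 2 * k) / 2 = k := by omega
  fin_cases s <;>
    simp [realBasis, realFrame, Module.Basis.smulTower_apply] at h1 h2 ⊢
  all_goals simp [h2]

theorem covec_eq_zero_of_basis {ι : Type*} [Finite ι] {k : ℕ} (F : Module.Basis ι ℝ (Cn n))
    (hk : Fin k ≃ ι) {γ : Covec n k} (h : γ (fun i => F (hk i)) = 0) : γ = 0 := by
  have key : γ.toAlternatingMap = 0 := by
    refine Module.Basis.ext_alternating (F.reindex hk.symm) fun i hi => ?_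
    let σ : Equiv.Perm (Fin k) := Equiv.ofBijective i (Finite.injective_iff_bijective.1 hi)
    have : γ.toAlternatingMap ((fun i => F (hk i)) ∘ σ) = 0 := by
      rw [AlternatingMap.map_perm]
      change _ • γ (fun i => F (hk i)) = 0
      rw [h, smul_zero]
    simpa [σ, Function.comp_def] using this
  ext v
  exact DFunLike.congr_fun key v

theorem covec_eq_zero_of_realFrame {k : ℕ} (hk : k = 2 * n) {γ : Covec n k}
    (h : γ (fun i => realFrame n (Fin.cast hk i)) = 0) : γ = 0 := by
  refine covec_eq_zero_of_basis (realBasis n) (finCongr hk) ?_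
  rw [coe_realBasis]
  exact h

end WedgeAlgebra

/-! ### Sums over bijections versus sums over functions. -/

theorem exists_perm_comp_eq {α γ : Type*} [Finite α] [Finite γ] {j j' : α → γ}
    (hj : Function.Injective j) (hj' : Function.Injective j') :
    ∃ ρ : Equiv.Perm γ, ∀ a, ρ (j a) = j' a := by
  classical
  cases nonempty_fintype γ
  let e : Set.range j ≃ Set.range j' :=
    (Equiv.ofInjective j hj).symm.trans (Equiv.ofInjective j' hj')
  refine ⟨e.extendSubtype, fun a => ?_⟩
  rw [Equiv.extendSubtype_apply_of_mem e (j a) ⟨a, rfl⟩]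
  simp [e]

/-- The number of bijections `τ` with `τ ∘ i = j` is the same for every injective `j`, because
permutations of `γ` act transitively on injective maps. The count at `τ₀ ∘ i` therefore serves as
the common factor. -/
theorem sum_equiv_comp {α δ γ : Type*} [Fintype α] [Fintype δ] [Fintype γ]
    [DecidableEq α] [DecidableEq δ] [DecidableEq γ] {i : α → δ} (hi : Function.Injective i)
    (f : (α → γ) → ℂ) (hf : ∀ j, ¬ Function.Injective j → f j = 0) (τ₀ : δ ≃ γ) :
    ∑ τ : δ ≃ γ, f (τ ∘ i) =
      ((Finset.univ.filter fun τ : δ ≃ γ => (τ ∘ i : α → γ) = τ₀ ∘ i).card : ℂ) * ∑ j, f j := by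
  rw [← Finset.sum_fiberwise (s := Finset.univ) (g := fun τ : δ ≃ γ => (τ ∘ i : α → γ)),
    Finset.mul_sum]
  refine Finset.sum_congr rfl fun j _ => ?_
  have h1 : ∑ τ ∈ Finset.univ.filter fun τ : δ ≃ γ => (τ ∘ i : α → γ) = j, f (τ ∘ i) =
      ∑ τ ∈ Finset.univ.filter fun τ : δ ≃ γ => (τ ∘ i : α → γ) = j, f j :=
    Finset.sum_congr rfl fun τ hτ => by rw [(Finset.mem_filter.1 hτ).2]
  rw [h1, Finset.sum_const, nsmul_eq_mul]
  by_cases hj : Function.Injective j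
  · obtain ⟨ρ, hρ⟩ := exists_perm_comp_eq hj (τ₀.injective.comp hi)
    congr 2
    refine Finset.card_equiv (Equiv.equivCongr (Equiv.refl δ) ρ) fun τ => ?_
    simp only [Finset.mem_filter, Finset.mem_univ, true_and]
    constructor
    · rintro rfl
      funext a
      simpa using hρ a
    · intro h
      funext a
      have := congrFun h a
      simp only [Function.comp_apply, Equiv.equivCongr_apply_apply, Equiv.refl_symm,
        Equiv.refl_apply] at this
      exact ρ.injective (this.trans (hρ a).symm)
  · rw [hf j hj, mul_zero, mul_zero]

theorem sum_equiv_comp_coeff_ne_zero {α δ γ : Type*} [Fintype α] [Fintype δ] [Fintype γ]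
    [DecidableEq α] [DecidableEq δ] [DecidableEq γ] (i : α → δ) (τ₀ : δ ≃ γ) :
    ((Finset.univ.filter fun τ : δ ≃ γ => (τ ∘ i : α → γ) = τ₀ ∘ i).card : ℂ) ≠ 0 := by
  rw [Nat.cast_ne_zero, Finset.card_ne_zero]
  exact ⟨τ₀, by simp⟩

/-! ### Unitary frames, powers of `Ω`, and the double trace of a `4`-covector. -/

section UnitaryFrame

variable {n : ℕ}

/-- The bijection `2 * i + s ↔ (i, s)`. -/
def pairEquiv (k : ℕ) : Fin (2 * k) ≃ Fin k × Fin 2 :=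
  (finCongr (mul_comm 2 k)).trans finProdFinEquiv.symm

/-- The tuple `(F (j 0, 0), F (j 0, 1), F (j 1, 0), F (j 1, 1), …)`. -/
def pairs (F : Fin n × Fin 2 → Cn n) {k : ℕ} (j : Fin k → Fin n) (i : Fin (2 * k)) : Cn n :=
  F (j (pairEquiv k i).1, (pairEquiv k i).2)

theorem pairEquiv_symm_val {k : ℕ} (p : Fin k × Fin 2) :
    ((pairEquiv k).symm p : ℕ) = p.2 + 2 * p.1 := rfl

theorem append_pairs (F : Fin n × Fin 2 → Cn n) {k : ℕ} (j : Fin k → Fin n) (l : Fin n) :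
    Fin.append (pairs F j) (![F (l, 0), F (l, 1)] : Fin 2 → Cn n) =
      pairs F (Fin.snoc j l : Fin (k + 1) → Fin n) := by
  funext i
  induction i using Fin.addCases with
  | left i =>
    have h1 : pairEquiv (k + 1) (Fin.castAdd 2 i) =
        ((pairEquiv k i).1.castSucc, (pairEquiv k i).2) := by
      rw [← Equiv.eq_symm_apply (pairEquiv (k + 1))]
      ext
      rw [pairEquiv_symm_val]
      have := pairEquiv_symm_val (pairEquiv k i)
      rw [Equiv.symm_apply_apply] at this
      exact this
    rw [Fin.append_left, pairs]
    change _ = F (_, _)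
    rw [show (pairEquiv (k + 1) (Fin.castAdd 2 i)) = _ from h1]
    simp
  | right i =>
    have h1 : pairEquiv (k + 1) (Fin.natAdd (2 * k) i) = (Fin.last k, i) := by
      rw [← Equiv.eq_symm_apply (pairEquiv (k + 1))]
      ext
      rw [pairEquiv_symm_val]
      simp [add_comm]
    rw [Fin.append_right]
    change _ = F (_, _)
    rw [show (pairEquiv (k + 1) (Fin.natAdd (2 * k) i)) = _ from h1]
    fin_cases i <;> simp

theorem pairs_two (F : Fin n × Fin 2 → Cn n) (j : Fin 2 → Fin n) :
    pairs F j = ![F (j 0, 0), F (j 0, 1), F (j 1, 0), F (j 1, 1)] := by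
  funext i
  fin_cases i <;> rfl

/-- A real orthonormal basis `(e₁, i e₁, …, e_n, i e_n)` for the inner product `h`. -/
structure IsUnitaryFrame (h : Cn n →L[ℝ] Cn n →L[ℝ] ℝ) (F : Module.Basis (Fin n × Fin 2) ℝ (Cn n)) :
    Prop where
  orthonormal : ∀ p q, h (F p) (F q) = if p = q then 1 else 0
  mulI_fst : ∀ j, mulI n (F (j, 0)) = F (j, 1)

variable {h : Cn n →L[ℝ] Cn n →L[ℝ] ℝ} {F : Module.Basis (Fin n × Fin 2) ℝ (Cn n)}

namespace IsUnitaryFrame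

theorem mulI_snd (hF : IsUnitaryFrame h F) (j : Fin n) : mulI n (F (j, 1)) = -F (j, 0) := by
  rw [← hF.mulI_fst, mulI_mulI]

theorem sum_eq (hF : IsUnitaryFrame h F) (v : Cn n) : ∑ p, h (F p) v • F p = v := by
  conv_rhs => rw [← F.sum_repr v]
  refine Finset.sum_congr rfl fun p _ => ?_
  congr 1
  conv_lhs => rw [← F.sum_repr v]
  rw [map_sum]
  simp [-Module.Basis.sum_repr, hF.orthonormal]

theorem sum_mul (hF : IsUnitaryFrame h F) (v w : Cn n) :
    ∑ p, h (F p) v * h (F p) w = h v w := by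
  conv_rhs => rw [← hF.sum_eq v]
  simp only [map_sum, map_smul, _root_.sum_apply, smul_apply, smul_eq_mul]

theorem eq_sum_flatWedge (hF : IsUnitaryFrame h F) (hJ : ∀ v w, h (mulI n v) (mulI n w) = h v w)
    {Ω : Covec n 2} (hΩ : ∀ v, Ω v = (h (mulI n (v 0)) (v 1) : ℂ)) :
    Ω = ∑ j, flatWedge h ![F (j, 0), F (j, 1)] := by
  have hJ2 : ∀ v w, h v (mulI n w) = - h (mulI n v) w := fun v w => by
    rw [← hJ v, mulI_mulI, map_neg]
  ext v
  rw [hΩ, ← hF.sum_mul, Fintype.sum_prod_type, ContinuousAlternatingMap.sum_apply,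
    Complex.ofReal_sum]
  refine Finset.sum_congr rfl fun j _ => ?_
  rw [flatWedge_apply, Matrix.det_fin_two]
  simp [hJ2, hF.mulI_fst, hF.mulI_snd, -mulI_apply]
  ring

/-- The sum runs over all functions `j`, repetitions included. This spares any factorial, since
non-injective `j` contribute zero. -/
theorem wedgePow_eq_sum {Ω : Covec n 2}
    (hΩ : Ω = ∑ j, flatWedge h ![F (j, 0), F (j, 1)]) (k : ℕ) :
    wedgePow Ω k = ∑ j : Fin k → Fin n, flatWedge h (pairs F j) := by
  induction k with
  | zero =>
    ext v
    simp [wedgePow, flatWedge_apply]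
  | succ k ih =>
    change wedge (wedgePow Ω k) Ω = _
    rw [ih, ← (Fin.snocEquiv fun _ : Fin (k + 1) => Fin n).sum_comp, Fintype.sum_prod_type]
    change wedgeLeft 2 _ Ω = _
    rw [hΩ, map_sum]
    refine Finset.sum_congr rfl fun l _ => ?_
    change wedgeRight (2 * k) _ _ = _
    rw [map_sum]
    refine Finset.sum_congr rfl fun j _ => ?_
    change wedge _ _ = _
    rw [flatWedge_wedge_flatWedge, append_pairs]
    rfl

/-- The reindexing of `m + 2` pairs of basis vectors by `Fin (2 * 2 + 2 * m)`. -/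
def pairSumEquiv (m : ℕ) : Fin (2 * 2 + 2 * m) ≃ (Fin 2 ⊕ Fin m) × Fin 2 :=
  finSumFinEquiv.symm.trans (((pairEquiv 2).sumCongr (pairEquiv m)).trans
    (Equiv.sumProdDistrib _ _ _).symm)

theorem append_pairs_pairs {m : ℕ} (F : Fin n × Fin 2 → Cn n) (τ : Fin 2 ⊕ Fin m ≃ Fin n) :
    Fin.append (pairs F (τ ∘ Sum.inl)) (pairs F (τ ∘ Sum.inr)) =
      fun i => F (τ (pairSumEquiv m i).1, (pairSumEquiv m i).2) := by
  funext i
  induction i using Fin.addCases with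
  | left i => rw [Fin.append_left]; simp [pairs, pairSumEquiv]
  | right i => rw [Fin.append_right]; simp [pairs, pairSumEquiv]

/-- The value of a top form on a frame does not change if pairs of frame vectors are permuted. -/
theorem map_append_pairs {m : ℕ} (γ : Covec n (2 * 2 + 2 * m)) (F : Fin n × Fin 2 → Cn n)
    (τ τ₀ : Fin 2 ⊕ Fin m ≃ Fin n) :
    γ (Fin.append (pairs F (τ ∘ Sum.inl)) (pairs F (τ ∘ Sum.inr))) =
      γ (Fin.append (pairs F (τ₀ ∘ Sum.inl)) (pairs F (τ₀ ∘ Sum.inr))) := by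
  let ρ : Equiv.Perm ((Fin 2 ⊕ Fin m) × Fin 2) :=
    Equiv.prodCongrLeft fun _ => τ.trans τ₀.symm
  -- The permutation acts identically on the two copies indexed by `Fin 2`, so its sign is a square.
  have hρ : Equiv.Perm.sign ρ = 1 := by
    rw [Equiv.Perm.sign_prodCongrLeft]
    simp
  have h1 : Fin.append (pairs F (τ ∘ Sum.inl)) (pairs F (τ ∘ Sum.inr)) =
      Fin.append (pairs F (τ₀ ∘ Sum.inl)) (pairs F (τ₀ ∘ Sum.inr)) ∘
        ((pairSumEquiv m).symm.permCongr ρ) := by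
    rw [append_pairs_pairs, append_pairs_pairs]
    funext i
    simp [ρ, Equiv.permCongr_apply, Equiv.prodCongrLeft]
  rw [h1]
  change γ.toAlternatingMap _ = _
  rw [AlternatingMap.map_perm, Equiv.Perm.sign_permCongr, hρ, one_smul]
  rfl

theorem flatWedge_pairs_self (hF : IsUnitaryFrame h F) {m : ℕ} {j : Fin m → Fin n}
    (hj : Function.Injective j) : flatWedge h (pairs F j) (pairs F j) = 1 := by
  rw [flatWedge_apply]
  have : (Matrix.of fun a b => h (pairs F j a) (pairs F j b)) = 1 := by
    ext a b
    rw [Matrix.of_apply, pairs, pairs, hF.orthonormal, Matrix.one_apply]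
    refine if_congr ?_ rfl rfl
    rw [Prod.mk.injEq, hj.eq_iff, ← Prod.ext_iff, (pairEquiv m).injective.eq_iff]
  rw [this, Matrix.det_one, Complex.ofReal_one]

theorem flatWedge_pairs_eq_zero {m : ℕ} (F : Fin n × Fin 2 → Cn n) {j : Fin m → Fin n}
    (hj : ¬ Function.Injective j) : flatWedge h (pairs F j) = 0 := by
  obtain ⟨a, b, hab, hne⟩ : ∃ a b, j a = j b ∧ a ≠ b := by
    simpa [Function.Injective] using hj
  refine (flatWedgeAlt (2 * m) h).map_eq_zero_of_eq _
    (i := (pairEquiv m).symm (a, 0)) (j := (pairEquiv m).symm (b, 0)) ?_ ?_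
  · simp [pairs, hab]
  · simpa using hne

/-- By orthonormality the second factor kills every frame vector among the first four arguments, so
`wedge_append` leaves one term. -/
theorem wedge_flatWedge_pairs (hF : IsUnitaryFrame h F) {m : ℕ} (β : Covec n 4)
    (τ : Fin 2 ⊕ Fin m ≃ Fin n) :
    wedge (p := 2 * 2) β (flatWedge h (pairs F (τ ∘ Sum.inr)))
      (Fin.append (pairs F (τ ∘ Sum.inl)) (pairs F (τ ∘ Sum.inr))) =
      β (pairs F (τ ∘ Sum.inl)) := by
  rw [wedge_append, hF.flatWedge_pairs_self (τ.injective.comp Sum.inr_injective), mul_one]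
  rintro w ⟨i, k, hik⟩
  rw [flatWedge_apply, Matrix.det_eq_zero_of_column_eq_zero i, Complex.ofReal_zero]
  intro a
  rw [Matrix.of_apply, hik, pairs, pairs, hF.orthonormal, if_neg]
  simp

/-- If `β ∧ Ωⁿ⁻² = 0` for a `4`-covector `β`, then the double trace of `β` vanishes. -/
theorem sum_eq_zero_of_wedge_wedgePow (hF : IsUnitaryFrame h F)
    (hJ : ∀ v w, h (mulI n v) (mulI n w) = h v w)
    {Ω : Covec n 2} (hΩ : ∀ v, Ω v = (h (mulI n (v 0)) (v 1) : ℂ)) (hn : 2 ≤ n) {β : Covec n 4}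
    (hβ : wedge β (wedgePow Ω (n - 2)) = 0) :
    ∑ a, ∑ b, β ![F (a, 0), F (a, 1), F (b, 0), F (b, 1)] = 0 := by
  obtain ⟨m, hm⟩ : ∃ m, m = n - 2 := ⟨_, rfl⟩
  rw [← hm] at hβ
  let τ₀ : Fin 2 ⊕ Fin m ≃ Fin n := finSumFinEquiv.trans (finCongr (by omega))
  let G := Fin.append (pairs F (τ₀ ∘ Sum.inl)) (pairs F (τ₀ ∘ Sum.inr))
  have h0 : ∑ j : Fin m → Fin n, wedge (p := 2 * 2) β (flatWedge h (pairs F j)) G = 0 := by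
    rw [wedgePow_eq_sum (hF.eq_sum_flatWedge hJ hΩ)] at hβ
    change wedgeLeft _ β _ = 0 at hβ
    rw [map_sum] at hβ
    rw [← ContinuousAlternatingMap.sum_apply]
    exact DFunLike.congr_fun hβ G
  have h1 := sum_equiv_comp (i := (Sum.inr : Fin m → Fin 2 ⊕ Fin m)) Sum.inr_injective
    (fun j : Fin m → Fin n => wedge (p := 2 * 2) β (flatWedge h (pairs F j)) G)
    (fun j hj => by
      change wedgeLeft _ (p := 2 * 2) β _ G = 0
      rw [flatWedge_pairs_eq_zero F hj, map_zero]
      rfl) τ₀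
  have h2 := sum_equiv_comp (i := (Sum.inl : Fin 2 → Fin 2 ⊕ Fin m)) Sum.inl_injective
    (fun j : Fin 2 → Fin n => β (pairs F j))
    (fun j hj => by
      obtain ⟨a, b, hab, hne⟩ : ∃ a b, j a = j b ∧ a ≠ b := by
        unfold Function.Injective at hj
        push Not at hj
        exact hj
      refine β.map_eq_zero_of_eq _
        (i := (pairEquiv 2).symm (a, 0)) (j := (pairEquiv 2).symm (b, 0)) ?_ ?_
      · simp [pairs, hab]
      · simpa using hne) τ₀
  rw [h0, mul_zero] at h1
  -- A bijection `τ` splits the `n` complex lines into two fed to `β` and `m` fed to `Ωᵐ`. Averaging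
  -- over `τ` links the expansion of `β ∧ Ωᵐ` (restriction to `inr`) with the double trace of `β`
  -- (restriction to `inl`).
  have h3 : ∑ τ : Fin 2 ⊕ Fin m ≃ Fin n, β (pairs F (τ ∘ Sum.inl)) = 0 := by
    rw [← h1]
    refine Finset.sum_congr rfl fun τ _ => ?_
    rw [← hF.wedge_flatWedge_pairs β τ]
    exact map_append_pairs _ _ _ _
  rw [h3, zero_eq_mul] at h2
  have h4 := h2.resolve_left (sum_equiv_comp_coeff_ne_zero _ _)
  rw [← (finTwoArrowEquiv (Fin n)).symm.sum_comp, Fintype.sum_prod_type] at h4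
  rw [← h4]
  refine Finset.sum_congr rfl fun a _ => Finset.sum_congr rfl fun b _ => ?_
  rw [pairs_two]
  simp

end IsUnitaryFrame
end UnitaryFrame

/-! ### Existence of unitary frames, injectivity of the star, contractions of top forms. -/

section HermitianForms

variable {n : ℕ}

/-- `h` is a real inner product on `ℂⁿ` for which multiplication by `i` is orthogonal. -/
structure IsHermitianForm (h : Cn n →L[ℝ] Cn n →L[ℝ] ℝ) : Prop where
  symm : ∀ v w, h v w = h w v
  pos : ∀ v, v ≠ 0 → 0 < h v v
  mulI_mulI : ∀ v w, h (mulI n v) (mulI n w) = h v w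

/-- Stated for an abstract space so that the given inner product does not compete with the Euclidean
one on `ℂⁿ`. -/
theorem exists_basis_orthonormal_of_core {V : Type*} [AddCommGroup V] [Module ℂ V]
    [FiniteDimensional ℂ V] (c : InnerProductSpace.Core ℂ V) :
    ∃ e : Module.Basis (Fin (Module.finrank ℂ V)) ℂ V,
      ∀ i j, c.inner (e i) (e j) = if i = j then 1 else 0 := by
  let _ := c.toNormedAddCommGroup
  let _ := InnerProductSpace.ofCore c.toCore
  refine ⟨(stdOrthonormalBasis ℂ V).toBasis, fun i j => ?_⟩
  have := orthonormal_iff_ite.1 (stdOrthonormalBasis ℂ V).orthonormal i j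
  simpa using this

namespace IsHermitianForm

variable {h : Cn n →L[ℝ] Cn n →L[ℝ] ℝ}

theorem apply_mulI (hh : IsHermitianForm h) (v w : Cn n) : h v (mulI n w) = -h (mulI n v) w := by
  rw [← hh.mulI_mulI v, HermitianGeometry.mulI_mulI, map_neg]

/-- The complex inner product with real part `h`. -/
@[reducible]
def core (hh : IsHermitianForm h) : InnerProductSpace.Core ℂ (Cn n) where
  -- The minus sign makes the form conjugate-linear in its first argument.
  inner v w := ⟨h v w, -h v (mulI n w)⟩
  conj_inner_symm v w := by
    apply Complex.ext
    · simp [hh.symm v w]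
    · have := hh.apply_mulI w v
      simp [-mulI_apply, this, hh.symm v]
  re_inner_nonneg v := by
    by_cases hv : v = 0
    · simp [hv]
    · exact (hh.pos v hv).le
  add_left u v w := by
    apply Complex.ext
    · simp
    · simp [-mulI_apply]; ring
  smul_left v w r := by
    have hr : r • v = r.re • v + r.im • mulI n v := by
      conv_lhs => rw [← Complex.re_add_im r, add_smul, mul_smul]
      rfl
    have := hh.apply_mulI v w
    apply Complex.ext
    · simp [-mulI_apply, hr, this]
    · simp [-mulI_apply, hr, this, hh.mulI_mulI]; ring
  definite v hv := by
    by_contra hne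
    exact (hh.pos v hne).ne' (congrArg Complex.re hv)

theorem exists_isUnitaryFrame (hh : IsHermitianForm h) :
    ∃ F : Module.Basis (Fin n × Fin 2) ℝ (Cn n), IsUnitaryFrame h F := by
  obtain ⟨e, he⟩ := exists_basis_orthonormal_of_core hh.core
  have hn : Module.finrank ℂ (Cn n) = n := finrank_euclideanSpace_fin
  let e' : Module.Basis (Fin n) ℂ (Cn n) := e.reindex (finCongr hn)
  have he' : ∀ i j, (⟨h (e' i) (e' j), -h (e' i) (mulI n (e' j))⟩ : ℂ) = if i = j then 1 else 0 := by
    intro i j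
    have := he ((finCongr hn).symm i) ((finCongr hn).symm j)
    simp only [EmbeddingLike.apply_eq_iff_eq] at this
    simp only [e', Module.Basis.reindex_apply]
    exact this
  have h1 : ∀ i j, h (e' i) (e' j) = if i = j then 1 else 0 := fun i j => by
    have := congrArg Complex.re (he' i j)
    rw [apply_ite Complex.re] at this
    simpa using this
  have h2 : ∀ i j, h (e' i) (mulI n (e' j)) = 0 := fun i j => by
    have := congrArg Complex.im (he' i j)
    rw [apply_ite Complex.im] at this
    simpa [-mulI_apply] using this
  let F : Module.Basis (Fin n × Fin 2) ℝ (Cn n) :=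
    (Complex.basisOneI.smulTower e').reindex (Equiv.prodComm _ _)
  have hF0 : ∀ j, F (j, 0) = e' j := fun j => by simp [F, Module.Basis.smulTower_apply]
  have hF1 : ∀ j, F (j, 1) = mulI n (e' j) := fun j => by simp [F, Module.Basis.smulTower_apply]
  refine ⟨F, ⟨?_, fun j => by rw [hF0, hF1]⟩⟩
  rintro ⟨j, s⟩ ⟨k, t⟩
  fin_cases s <;> fin_cases t <;>
    simp [hF0, hF1, hh.mulI_mulI, hh.symm (mulI n _) (e' _), h1, h2, -mulI_apply]

/-- The Hodge star operator is injective on covectors of degree `2 n - 1`. -/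
theorem eq_zero_of_hodgeStar_eq_zero (hh : IsHermitianForm h) {k : ℕ} (hk : k + 1 = 2 * n)
    (hdet : 0 < Matrix.det (Matrix.of fun i j => h (realFrame n i) (realFrame n j)))
    {γ : Covec n k} (hγ : hodgeStar hk h γ = 0) : γ = 0 := by
  ext x
  -- The `2n - 1` vectors `x i` have a common orthogonal vector `y ≠ 0`. Evaluating `γ ∧ y♭` on `(x,
  -- y)` then leaves only `γ x * h y y`.
  obtain ⟨y, hy0, hy⟩ : ∃ y : Cn n, y ≠ 0 ∧ ∀ i, h (x i) y = 0 := by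
    let T : Cn n →ₗ[ℝ] (Fin k → ℝ) := LinearMap.pi fun i => (h (x i)).toLinearMap
    have hT : LinearMap.ker T ≠ ⊥ := by
      refine LinearMap.ker_ne_bot_of_finrank_lt ?_
      rw [Module.finrank_eq_card_basis (realBasis n)]
      simp
      omega
    obtain ⟨y, hy, hy0⟩ := (Submodule.ne_bot_iff _).1 hT
    exact ⟨y, hy0, fun i => congrFun (LinearMap.mem_ker.1 hy) i⟩
  have h1 : wedge γ (flatWedge h ![y]) = 0 := by
    refine covec_eq_zero_of_realFrame hk ?_
    have h2 := hodgeStar_apply hk h γ ![y]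
    rw [hγ] at h2
    have h3 := (smul_eq_zero.1 h2.symm).resolve_left
      (inv_ne_zero (Real.sqrt_ne_zero'.2 hdet))
    exact h3
  have h2 := wedge_append γ (flatWedge h ![y]) x ![y] (by
    rintro w ⟨i, j, hw⟩
    rw [flatWedge_apply, Matrix.det_unique]
    have hw0 : w 0 = x j := by rw [← hw, Subsingleton.elim i 0]
    simp [hw0, hh.symm y, hy])
  rw [h1, flatWedge_apply, Matrix.det_unique] at h2
  have h3 : (h y y : ℂ) ≠ 0 := Complex.ofReal_ne_zero.2 (hh.pos y hy0).ne'
  have h4 : γ x * (h y y : ℂ) = 0 := by simpa using h2.symm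
  exact (mul_eq_zero.1 h4).resolve_right h3

end IsHermitianForm

section TopForms

variable {m : ℕ}

/-- In dimension `m + 2`, a linear form wedged with a top form vanishes. -/
theorem contract_top (hm : m + 2 = 2 * n) (vol : Covec n (m + 2)) (l : Cn n →L[ℝ] ℝ) (x y : Cn n)
    (v : Fin (m + 1) → Cn n) :
    ∑ i : Fin (m + 1), (-1 : ℤ) ^ (i : ℕ) • l (v i) •
      vol (Matrix.vecCons x (Matrix.vecCons y (i.removeNth v))) =
      l y • vol (Matrix.vecCons x v) - l x • vol (Matrix.vecCons y v) := by
  -- This is `l ∧ vol`, of degree `2n + 1`. The identity is its expansion on `(x, y, v)`.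
  have h0 : ContinuousAlternatingMap.alternatizeUncurryFin (l.smulRight vol)
      (Matrix.vecCons x (Matrix.vecCons y v)) = 0 := by
    refine AlternatingMap.map_linearDependent
      (ContinuousAlternatingMap.alternatizeUncurryFin (l.smulRight vol)).toAlternatingMap _
      fun hli => ?_
    have := hli.fintype_card_le_finrank
    rw [Module.finrank_eq_card_basis (realBasis n), Fintype.card_fin, Fintype.card_fin] at this
    omega
  rw [ContinuousAlternatingMap.alternatizeUncurryFin_apply, Fin.sum_univ_succ,
    Fin.sum_univ_succ] at h0
  have h1 : ∀ i : Fin (m + 1), i.succ.succ.removeNth (Matrix.vecCons x (Matrix.vecCons y v)) =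
      Matrix.vecCons x (Matrix.vecCons y (i.removeNth v)) := by
    intro i
    funext k
    refine Fin.cases ?_ (fun k => ?_) k
    · simp [Fin.removeNth]
    · refine Fin.cases ?_ (fun k => ?_) k
      · simp [Fin.removeNth]
      · simp [Fin.removeNth]
  have h2 : (0 : Fin (m + 3)).removeNth (Matrix.vecCons x (Matrix.vecCons y v)) =
      Matrix.vecCons y v := by
    funext k; simp [Fin.removeNth]
  have h3 : (0 : Fin (m + 2)).succ.removeNth (Matrix.vecCons x (Matrix.vecCons y v)) =
      Matrix.vecCons x v := by
    funext k
    refine Fin.cases ?_ (fun k => ?_) k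
    · simp [Fin.removeNth]
    · simp [Fin.removeNth]
  simp only [h1, h2, h3] at h0
  simp [pow_add] at h0
  simp only [zsmul_eq_mul, Complex.real_smul]
  push_cast
  linear_combination h0

/-- A vector whose interior product with a nonzero top form vanishes is zero. -/
theorem eq_zero_of_contract_top (F : Module.Basis (Fin (m + 1)) ℝ (Cn n)) {vol : Covec n (m + 1)}
    (hvol : vol F ≠ 0) {x : Cn n} (hx : ∀ v, vol (Matrix.vecCons x v) = 0) : x = 0 := by
  have h1 : ∀ k (w : Fin (m + 1) → Cn n), w k = x → vol w = 0 := by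
    intro k w hw
    have := vol.toAlternatingMap.map_perm w (Equiv.swap 0 k)
    have h2 : w ∘ Equiv.swap 0 k = Matrix.vecCons x (Fin.tail (w ∘ Equiv.swap 0 k)) := by
      funext i
      refine Fin.cases ?_ (fun i => ?_) i
      · simp [hw]
      · simp [Fin.tail]
    rw [h2] at this
    change vol _ = _ • vol w at this
    rw [hx] at this
    exact (smul_eq_zero_iff_eq _).1 this.symm
  apply F.repr.injective
  rw [map_zero]
  ext k
  have h2 := h1 k (Function.update F k x) (by simp)
  conv at h2 => rw [← F.sum_repr x]
  -- Replacing the `k`-th basis vector by `x` multiplies the volume by the `k`-th coordinate of `x`.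
  have h3 : vol (Function.update F k (∑ i, F.repr x i • F i)) = F.repr x k • vol F := by
    change vol.toAlternatingMap _ = _
    rw [AlternatingMap.map_update_sum, Finset.sum_eq_single k]
    · rw [AlternatingMap.map_update_smul, Function.update_eq_self]
      rfl
    · intro i _ hik
      rw [AlternatingMap.map_update_smul, AlternatingMap.map_update_self _ _ hik.symm, smul_zero]
    · simp
  rw [h3] at h2
  exact (smul_eq_zero.1 h2).resolve_right hvol

end TopForms

end HermitianForms

/-! ### Derivatives of determinants and inverse matrices. -/

theorem fderiv_apply_apply {E X Y G : Type*} [NormedAddCommGroup E] [NormedSpace ℝ E]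
    [NormedAddCommGroup X] [NormedSpace ℝ X] [NormedAddCommGroup Y] [NormedSpace ℝ Y]
    [NormedAddCommGroup G] [NormedSpace ℝ G] {f : E → X →L[ℝ] Y →L[ℝ] G} {z : E}
    (hf : DifferentiableAt ℝ f z) (u : E) (x : X) (y : Y) :
    fderiv ℝ (fun w => f w x y) z u = fderiv ℝ f z u x y := by
  have h1 : DifferentiableAt ℝ (fun w => f w x) z := hf.clm_apply (differentiableAt_const x)
  rw [fderiv_clm_apply h1 (differentiableAt_const y), fderiv_clm_apply hf (differentiableAt_const x)]
  simp

section MatrixCalculus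

variable {E ι : Type*} [NormedAddCommGroup E] [NormedSpace ℝ E] [Fintype ι] [DecidableEq ι]
  {A : E → Matrix ι ι ℝ} {A' : ι → ι → E →L[ℝ] ℝ} {z : E}

/-- Jacobi's formula. -/
theorem hasFDerivAt_det (hA : ∀ i j, HasFDerivAt (fun z => A z i j) (A' i j) z) :
    HasFDerivAt (fun z => (A z).det) (∑ j, ∑ i, (A z).adjugate j i • A' i j) z := by
  have h1 : HasFDerivAt (fun z => (A z).det) (∑ σ : Equiv.Perm ι, (Equiv.Perm.sign σ : ℤ) •
      ∑ j, (∏ k ∈ Finset.univ.erase j, A z (σ k) k) • A' (σ j) j) z := by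
    simp only [Matrix.det_apply]
    refine HasFDerivAt.fun_sum fun σ _ => ?_
    have := HasFDerivAt.finsetProd (u := Finset.univ) (x := z) fun k _ => hA (σ k) k
    have h2 := this.fun_const_smul ((Equiv.Perm.sign σ : ℤ) : ℝ)
    simpa [Units.smul_def, ← Int.cast_smul_eq_zsmul ℝ] using h2
  convert h1 using 1
  ext u
  have h2 : ∀ j, ∑ i, (A z).adjugate j i * A' i j u =
      ∑ σ : Equiv.Perm ι, ((Equiv.Perm.sign σ : ℤ) : ℝ) *
        ((∏ k ∈ Finset.univ.erase j, A z (σ k) k) * A' (σ j) j u) := by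
    intro j
    have h3 : ∑ i, (A z).adjugate j i * A' i j u =
        ((A z).updateCol j fun i => A' i j u).det := by
      rw [← Matrix.cramer_apply, Matrix.cramer_eq_adjugate_mulVec]
      rfl
    rw [h3, Matrix.det_apply']
    refine Finset.sum_congr rfl fun σ _ => ?_
    rw [← Finset.prod_erase_mul _ _ (Finset.mem_univ j), Matrix.updateCol_self]
    congr 2
    refine Finset.prod_congr rfl fun k hk => ?_
    rw [Matrix.updateCol_ne (Finset.ne_of_mem_erase hk)]
  simp only [_root_.sum_apply, _root_.smul_apply, smul_eq_mul, h2, zsmul_eq_mul,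
    Finset.mul_sum]
  exact Finset.sum_comm

theorem differentiableAt_det (hA : ∀ i j, DifferentiableAt ℝ (fun z => A z i j) z) :
    DifferentiableAt ℝ (fun z => (A z).det) z :=
  (hasFDerivAt_det fun i j => (hA i j).hasFDerivAt).differentiableAt

theorem differentiableAt_inv (hA : ∀ i j, DifferentiableAt ℝ (fun z => A z i j) z)
    (hdet : (A z).det ≠ 0) (p q : ι) : DifferentiableAt ℝ (fun z => (A z)⁻¹ p q) z := by
  have h1 : (fun z => (A z)⁻¹ p q) =
      fun z => (A z).det⁻¹ * ((A z).updateRow q (Pi.single p 1)).det := by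
    funext z
    rw [Matrix.inv_def, Matrix.smul_apply, Matrix.adjugate_apply, smul_eq_mul,
      Ring.inverse_eq_inv']
  rw [h1]
  refine ((differentiableAt_det hA).inv hdet).mul (differentiableAt_det fun i j => ?_)
  by_cases hi : i = q
  · subst hi
    simp
  · simpa [Matrix.updateRow_ne hi] using hA i j

theorem fderiv_inv (hA : ∀ i j, HasFDerivAt (fun z => A z i j) (A' i j) z)
    (hdet : (A z).det ≠ 0) (p q : ι) (u : E) :
    fderiv ℝ (fun z => (A z)⁻¹ p q) z u = -∑ r, ∑ s, (A z)⁻¹ p r * A' r s u * (A z)⁻¹ s q := by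
  have hB := differentiableAt_inv (fun i j => (hA i j).differentiableAt) hdet
  let D : Matrix ι ι ℝ := Matrix.of fun r s => A' r s u
  let B' : Matrix ι ι ℝ := Matrix.of fun r s => fderiv ℝ (fun z => (A z)⁻¹ r s) z u
  -- Derivative of `A * A⁻¹ = 1`, valid near `z` where the determinant stays nonzero.
  have h1 : D * (A z)⁻¹ + A z * B' = 0 := by
    ext r s
    have h2 : HasFDerivAt (fun z => ∑ k, A z r k * (A z)⁻¹ k s)
        (∑ k, (A z r k • fderiv ℝ (fun z => (A z)⁻¹ k s) z + (A z)⁻¹ k s • A' r k)) z :=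
      HasFDerivAt.fun_sum fun k _ => (hA r k).mul (hB k s).hasFDerivAt
    have h3 : (fun z => ∑ k, A z r k * (A z)⁻¹ k s) =ᶠ[𝓝 z] fun _ => (1 : Matrix ι ι ℝ) r s := by
      have hc := (differentiableAt_det fun i j => (hA i j).differentiableAt).continuousAt
      filter_upwards [hc.eventually_ne hdet] with y hy
      rw [← Matrix.mul_apply, Matrix.mul_nonsing_inv _ (isUnit_iff_ne_zero.2 hy)]
    have h4 := h2.unique ((hasFDerivAt_const _ _).congr_of_eventuallyEq h3)
    have h5 := DFunLike.congr_fun h4 u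
    simp only [_root_.sum_apply, _root_.add_apply, _root_.smul_apply,
      smul_eq_mul, _root_.zero_apply, Finset.sum_add_distrib] at h5
    rw [Matrix.add_apply, Matrix.mul_apply, Matrix.mul_apply, Matrix.zero_apply, ← h5, add_comm]
    simp [D, B', mul_comm]
  have h2 : B' = -((A z)⁻¹ * D * (A z)⁻¹) := by
    have := congrArg (fun X => (A z)⁻¹ * X) h1
    simp only [mul_add, mul_zero, ← mul_assoc,
      Matrix.nonsing_inv_mul _ (isUnit_iff_ne_zero.2 hdet), one_mul] at this
    exact eq_neg_of_add_eq_zero_right this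
  have h3 := congrFun (congrFun h2 p) q
  change fderiv ℝ (fun z => (A z)⁻¹ p q) z u = _ at h3
  rw [h3, Matrix.neg_apply, Matrix.mul_apply]
  simp only [Matrix.mul_apply, Finset.sum_mul, D, Matrix.of_apply]
  rw [Finset.sum_comm]

/-- The trace form of the divergence-free condition for `√(det A) A⁻¹`. -/
theorem trace_eq_of_div_eq_zero (hA : ∀ i j, HasFDerivAt (fun z => A z i j) (A' i j) z)
    (hsymm : (A z).transpose = A z) (hdet : 0 < (A z).det) (F : ι → E)
    (hdiv : ∀ p, ∑ q, fderiv ℝ (fun z => Real.sqrt (A z).det * (A z)⁻¹ q p) z (F q) = 0) (w : ι) :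
    ∑ p, ∑ q, (A z)⁻¹ p q * A' p q (F w) = 2 * ∑ p, ∑ q, (A z)⁻¹ p q * A' q w (F p) := by
  have hB := differentiableAt_inv (fun i j => (hA i j).differentiableAt) hdet.ne'
  set s := Real.sqrt (A z).det with hs
  have hs0 : s ≠ 0 := (Real.sqrt_pos.2 hdet).ne'
  have hss : s * s = (A z).det := Real.mul_self_sqrt hdet.le
  let t : E → ℝ := fun u => ∑ p, ∑ q, (A z)⁻¹ p q * A' p q u
  have hsym : ∀ p q, (A z)⁻¹ p q = (A z)⁻¹ q p := fun p q => by
    have := congrFun (congrFun (Matrix.transpose_nonsing_inv (A z)) q) p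
    rwa [hsymm] at this
  have hsqrt : ∀ u, fderiv ℝ (fun z => Real.sqrt (A z).det) z u = s / 2 * t u := by
    intro u
    have h1 := ((hasFDerivAt_det hA).sqrt hdet.ne').fderiv
    rw [h1]
    have h2 : (A z).adjugate = (A z).det • (A z)⁻¹ := by
      rw [Matrix.inv_def, smul_smul, Ring.inverse_eq_inv', mul_inv_cancel₀ hdet.ne', one_smul]
    have h3 : (∑ j, ∑ i, (A z).adjugate j i • A' i j) u = (A z).det * t u := by
      simp only [_root_.sum_apply, _root_.smul_apply, smul_eq_mul, h2, Matrix.smul_apply, t,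
        Finset.mul_sum]
      rw [Finset.sum_comm]
      refine Finset.sum_congr rfl fun p _ => Finset.sum_congr rfl fun q _ => ?_
      rw [hsym, mul_assoc]
    rw [_root_.smul_apply, h3, ← hs, ← hss, smul_eq_mul]
    field_simp
  have hds : DifferentiableAt ℝ (fun z => Real.sqrt (A z).det) z :=
    ((hasFDerivAt_det hA).sqrt hdet.ne').differentiableAt
  -- The divergence divided by `√(det A)`: Jacobi's formula gives the term with `t / 2`, and the
  -- derivative of the inverse gives the other. Contracting with `A p w` then removes the remaining
  -- inverse matrix.
  have h1 : ∀ p, ∑ q, (t (F q) / 2 * (A z)⁻¹ q p -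
      ∑ k, (∑ r, (A z)⁻¹ q r * A' r k (F q)) * (A z)⁻¹ k p) = 0 := by
    intro p
    have h2 := hdiv p
    have h3 : ∀ q, fderiv ℝ (fun z => Real.sqrt (A z).det * (A z)⁻¹ q p) z (F q) =
        s * (t (F q) / 2 * (A z)⁻¹ q p -
          ∑ k, (∑ r, (A z)⁻¹ q r * A' r k (F q)) * (A z)⁻¹ k p) := by
      intro q
      rw [fderiv_fun_mul hds (hB q p)]
      simp only [_root_.add_apply, _root_.smul_apply, smul_eq_mul, hsqrt,
        fderiv_inv hA hdet.ne', Finset.sum_mul]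
      rw [Finset.sum_comm]
      ring
    simp only [h3, ← Finset.mul_sum] at h2
    exact (mul_eq_zero.1 h2).resolve_left hs0
  have hinv : ∀ q, ∑ p, (A z)⁻¹ q p * A z p w = if q = w then 1 else 0 := by
    intro q
    rw [← Matrix.mul_apply, Matrix.nonsing_inv_mul _ (isUnit_iff_ne_zero.2 hdet.ne'),
      Matrix.one_apply]
  have h2 : ∑ p, (∑ q, (t (F q) / 2 * (A z)⁻¹ q p -
      ∑ k, (∑ r, (A z)⁻¹ q r * A' r k (F q)) * (A z)⁻¹ k p)) * A z p w = 0 :=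
    Finset.sum_eq_zero fun p _ => by rw [h1, zero_mul]
  have h3 : ∑ p, (∑ q, (t (F q) / 2 * (A z)⁻¹ q p -
      ∑ k, (∑ r, (A z)⁻¹ q r * A' r k (F q)) * (A z)⁻¹ k p)) * A z p w =
      t (F w) / 2 - ∑ q, ∑ r, (A z)⁻¹ q r * A' r w (F q) := by
    simp only [Finset.sum_mul, sub_mul]
    rw [Finset.sum_comm]
    simp only [Finset.sum_sub_distrib]
    congr 1
    · simp only [mul_assoc, ← Finset.mul_sum, hinv]
      simp
    · refine Finset.sum_congr rfl fun q _ => ?_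
      rw [Finset.sum_comm]
      have : ∀ k, ∑ p, ∑ r, (A z)⁻¹ q r * A' r k (F q) * (A z)⁻¹ k p * A z p w =
          (∑ r, (A z)⁻¹ q r * A' r k (F q)) * if k = w then 1 else 0 := by
        intro k
        rw [← hinv, Finset.sum_mul_sum, Finset.sum_comm]
        simp only [mul_assoc]
      simp only [this]
      simp
  rw [h3] at h2
  change t (F w) = _
  linarith

end MatrixCalculus

/-! ### The Hodge star of a varying metric in a fixed frame. -/

section Star

variable {n : ℕ} {h h₀ : Cn n →L[ℝ] Cn n →L[ℝ] ℝ} {F : Module.Basis (Fin n × Fin 2) ℝ (Cn n)}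

/-- The Gram matrix of `h` with respect to a family of vectors. -/
def gram {ι : Type*} (h : Cn n →L[ℝ] Cn n →L[ℝ] ℝ) (F : ι → Cn n) : Matrix ι ι ℝ :=
  Matrix.of fun p q => h (F p) (F q)

theorem gram_apply {ι : Type*} (h : Cn n →L[ℝ] Cn n →L[ℝ] ℝ) (F : ι → Cn n) (p q : ι) :
    gram h F p q = h (F p) (F q) := rfl

theorem IsHermitianForm.gram_transpose {ι : Type*} (hh : IsHermitianForm h) (F : ι → Cn n) :
    (gram h F).transpose = gram h F := by
  ext p q
  exact hh.symm _ _

theorem IsHermitianForm.det_gram_pos {ι : Type*} [Fintype ι] [DecidableEq ι]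
    (hh : IsHermitianForm h) (b : Module.Basis ι ℝ (Cn n)) : 0 < (gram h b).det := by
  refine Matrix.PosDef.det_pos (Matrix.PosDef.of_dotProduct_mulVec_pos ?_ fun x hx => ?_)
  · rw [Matrix.IsHermitian, Matrix.conjTranspose_eq_transpose_of_trivial]
    exact hh.gram_transpose b
  · have h1 : star x ⬝ᵥ (gram h b).mulVec x = h (∑ p, x p • b p) (∑ q, x q • b q) := by
      simp only [dotProduct, Matrix.mulVec, gram_apply, Finset.mul_sum, map_sum, map_smul,
        _root_.sum_apply, _root_.smul_apply, smul_eq_mul]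
      rw [Finset.sum_comm]
      refine Finset.sum_congr rfl fun q _ => Finset.sum_congr rfl fun p _ => ?_
      simp only [star_trivial]
      ring
    rw [h1]
    refine hh.pos _ fun h0 => hx ?_
    have := b.equivFun.symm.injective (a₁ := x) (a₂ := 0) (by
      rw [map_zero, Module.Basis.equivFun_symm_apply, h0])
    exact this

/-- The factorization `Wᵀ G B`, where `W` and `B` hold the coordinates of `w` and `b` in `F`, read
off with `h₀`. Two metrics occur because `F` is orthonormal only for the metric `h₀` at the chosen
point, while `h` is the metric at a nearby point. -/
theorem det_eq_mul_det_gram_mul (hF : IsUnitaryFrame h₀ F) {k : ℕ} (ε : Fin k ≃ Fin n × Fin 2)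
    (w b : Fin k → Cn n) :
    (Matrix.of fun i j => h (w i) (b j)).det =
      (Matrix.of fun i j => h₀ (F (ε i)) (w j)).det * (gram h F).det *
        (Matrix.of fun i j => h₀ (F (ε i)) (b j)).det := by
  rw [← Matrix.det_transpose (Matrix.of fun i j => h₀ (F (ε i)) (w j)),
    ← Matrix.det_submatrix_equiv_self ε (gram h F), ← Matrix.det_mul, ← Matrix.det_mul]
  congr 1
  ext i j
  conv_lhs => rw [Matrix.of_apply, ← hF.sum_eq (w i), ← hF.sum_eq (b j)]
  simp only [Matrix.mul_apply, Matrix.transpose_apply, Matrix.submatrix_apply, gram_apply,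
    Matrix.of_apply]
  have h1 : ∀ q, ∑ y, h₀ (F (ε y)) (w i) * h (F (ε y)) (F q) =
      ∑ p, h₀ (F p) (w i) * h (F p) (F q) := fun q =>
    ε.sum_comp fun p => h₀ (F p) (w i) * h (F p) (F q)
  simp only [h1]
  rw [ε.sum_comp fun q => (∑ p, h₀ (F p) (w i) * h (F p) (F q)) * h₀ (F q) (b j)]
  simp only [map_sum, map_smul, _root_.sum_apply, _root_.smul_apply, smul_eq_mul]
  exact Finset.sum_congr rfl fun q _ => mul_comm _ _

theorem flatWedge_comp_cast (h : Cn n →L[ℝ] Cn n →L[ℝ] ℝ) {k l : ℕ} (e : k = l)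
    (u w : Fin l → Cn n) :
    flatWedge h (u ∘ Fin.cast e) (w ∘ Fin.cast e) = flatWedge h u w := by
  subst e
  rfl

theorem append_eq_vecCons {m : ℕ} (x y : Cn n) (v : Fin m → Cn n) :
    Fin.append ![x, y] v =
      Matrix.vecCons x (Matrix.vecCons y v) ∘ Fin.cast (Nat.add_comm 2 m) := by
  funext i
  induction i using Fin.addCases with
  | left i => fin_cases i <;> simp <;> rfl
  | right i =>
    have : Fin.cast (Nat.add_comm 2 m) (Fin.natAdd 2 i) = i.succ.succ := by
      ext
      simp
    simp [this]

/-- The sign comparing the orientation of a unitary frame with the standard orientation. -/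
def frameSign (h₀ : Cn n →L[ℝ] Cn n →L[ℝ] ℝ) (F : Fin n × Fin 2 → Cn n) {k : ℕ}
    (hk : k = 2 * n) (ε : Fin k ≃ Fin n × Fin 2) : ℝ :=
  let D := (Matrix.of fun i j => h₀ (F (ε i)) (realFrame n (Fin.cast hk j))).det
  |D|⁻¹ * D

/-- The star of `x₁♭ ∧ ⋯ ∧ x_k♭` is the contraction of `vol_h` with the `x i`, and `vol_h` is `√(det
gram)` times the volume form of `h₀`. All dependence on `h` thus sits in one scalar. -/
theorem hodgeStar_flatWedge (hh : IsHermitianForm h) (hF : IsUnitaryFrame h₀ F) {k m : ℕ}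
    (hkm : k + m = 2 * n) (ε : Fin (k + m) ≃ Fin n × Fin 2) (x : Fin k → Cn n)
    (v : Fin m → Cn n) :
    hodgeStar hkm h (flatWedge h x) v =
      (frameSign h₀ F hkm ε * Real.sqrt (gram h F).det) •
        flatWedge h₀ (F ∘ ε) (Fin.append x v) := by
  have hpos := hh.det_gram_pos F
  have h1 : (Matrix.of fun i j => h (realFrame n i) (realFrame n j)).det =
      (Matrix.of fun i j => h (realFrame n (Fin.cast hkm i)) (realFrame n (Fin.cast hkm j))).det :=
    (Matrix.det_submatrix_equiv_self (finCongr hkm) _).symm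
  rw [hodgeStar_apply, flatWedge_wedge_flatWedge, flatWedge_apply, flatWedge_apply, h1,
    det_eq_mul_det_gram_mul (h := h) hF ε, det_eq_mul_det_gram_mul (h := h) hF ε (Fin.append x v),
    frameSign]
  set D := (Matrix.of fun i j => h₀ (F (ε i)) (realFrame n (Fin.cast hkm j))).det
  -- The change of basis `D` enters squared under the root but only once in the numerator, leaving
  -- the sign `D / |D|`.
  rw [show D * (gram h F).det * D = D ^ 2 * (gram h F).det by ring,
    Real.sqrt_mul (sq_nonneg D), Real.sqrt_sq_eq_abs, Complex.real_smul, Complex.real_smul,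
    ← Complex.ofReal_mul, ← Complex.ofReal_mul]
  congr 1
  have hs : Real.sqrt (gram h F).det ≠ 0 := (Real.sqrt_pos.2 hpos).ne'
  have h2 := Real.mul_self_sqrt hpos.le
  have h3 := inv_mul_cancel₀ hs
  set s := Real.sqrt (gram h F).det
  simp only [Function.comp_apply, mul_inv, ← h2]
  linear_combination (|D|⁻¹ * s * D *
    (Matrix.of fun i j => h₀ (F (ε i)) (Fin.append x v j)).det) * h3

theorem frameSign_ne_zero (hh : IsHermitianForm h₀) (hF : IsUnitaryFrame h₀ F) {k : ℕ}
    (hk : k = 2 * n) (ε : Fin k ≃ Fin n × Fin 2) : frameSign h₀ F hk ε ≠ 0 := by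
  have h1 := hh.det_gram_pos (realBasis n)
  have h2 : (gram h₀ (realBasis n)).det = (Matrix.of fun i j =>
      h₀ (realFrame n (Fin.cast hk i)) (realFrame n (Fin.cast hk j))).det := by
    rw [coe_realBasis]
    exact (Matrix.det_submatrix_equiv_self (finCongr hk) _).symm
  rw [h2, det_eq_mul_det_gram_mul hF ε] at h1
  have h3 : (Matrix.of fun i j => h₀ (F (ε i)) (realFrame n (Fin.cast hk j))).det ≠ 0 := by
    intro h0
    rw [h0, mul_zero] at h1
    exact h1.false
  exact mul_ne_zero (inv_ne_zero (abs_ne_zero.2 h3)) h3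

/-- The matrix of the complex structure in a unitary frame. -/
def frameJ (h₀ : Cn n →L[ℝ] Cn n →L[ℝ] ℝ) (F : Fin n × Fin 2 → Cn n) :
    Matrix (Fin n × Fin 2) (Fin n × Fin 2) ℝ :=
  Matrix.of fun q p => h₀ (F q) (mulI n (F p))

theorem sum_frameJ_smul (hF : IsUnitaryFrame h₀ F) (p : Fin n × Fin 2) :
    ∑ q, frameJ h₀ F q p • F q = mulI n (F p) := hF.sum_eq _

theorem sum_inv_gram_mul (hh : IsHermitianForm h) (u w : Cn n) :
    ∑ r, ∑ p, (gram h F)⁻¹ r p * (h (F r) u * h (F p) w) = h u w := by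
  have hu := isUnit_iff_ne_zero.2 (hh.det_gram_pos F).ne'
  have h1 : ∀ p q, ∑ r, (gram h F)⁻¹ r p * h (F r) (F q) = if p = q then 1 else 0 := by
    intro p q
    have h2 := congrFun (congrFun (Matrix.mul_nonsing_inv (gram h F) hu) q) p
    rw [Matrix.mul_apply, Matrix.one_apply] at h2
    rw [if_congr eq_comm rfl rfl, ← h2]
    refine Finset.sum_congr rfl fun r _ => ?_
    rw [gram_apply, hh.symm, mul_comm]
  have h3 : ∀ p, ∑ r, (gram h F)⁻¹ r p * h (F r) u = F.repr u p := by
    intro p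
    conv_lhs => rw [← F.sum_repr u]
    simp only [map_sum, map_smul, smul_eq_mul, Finset.mul_sum, mul_left_comm _ (F.repr u _)]
    rw [Finset.sum_comm]
    simp only [← Finset.mul_sum, h1]
    simp
  rw [Finset.sum_comm]
  simp only [← mul_assoc, ← Finset.sum_mul, h3]
  conv_rhs => rw [← F.sum_repr u]
  simp only [map_sum, map_smul, _root_.sum_apply, _root_.smul_apply, smul_eq_mul]

/-- `Ω` as a bivector with indices lowered by `h`: the form in which `hodgeStar_flatWedge` applies.
The factor `1 / 2` is there because both orders of each pair are summed. -/
theorem fundamental_eq_sum_flatWedge (hh : IsHermitianForm h) (hF : IsUnitaryFrame h₀ F)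
    {Ω : Covec n 2} (hΩ : ∀ v, Ω v = (h (mulI n (v 0)) (v 1) : ℂ)) :
    Ω = ∑ r, ∑ q, (((gram h F)⁻¹ * (frameJ h₀ F).transpose) r q / 2) •
      flatWedge h ![F r, F q] := by
  have h1 : ∀ u w, ∑ r, ∑ q, ((gram h F)⁻¹ * (frameJ h₀ F).transpose) r q *
      (h (F r) u * h (F q) w) = h (mulI n u) w := by
    intro u w
    rw [← neg_neg (h (mulI n u) w), ← hh.apply_mulI, ← sum_inv_gram_mul hh (F := F) u,
      ← Finset.sum_neg_distrib]
    refine Finset.sum_congr rfl fun r _ => ?_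
    simp only [Matrix.mul_apply, Finset.sum_mul, Matrix.transpose_apply]
    rw [Finset.sum_comm, ← Finset.sum_neg_distrib]
    refine Finset.sum_congr rfl fun p _ => ?_
    rw [hh.apply_mulI, ← sum_frameJ_smul hF]
    simp only [map_sum, map_smul, _root_.sum_apply, _root_.smul_apply, smul_eq_mul,
      Finset.mul_sum, mul_neg, neg_neg]
    refine Finset.sum_congr rfl fun q _ => ?_
    ring
  ext v
  have h2 := h1 (v 0) (v 1)
  have h3 := h1 (v 1) (v 0)
  rw [hΩ]
  have h4 : h (mulI n (v 0)) (v 1) = ∑ r, ∑ q,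
      ((gram h F)⁻¹ * (frameJ h₀ F).transpose) r q / 2 *
        (h (F r) (v 0) * h (F q) (v 1) - h (F r) (v 1) * h (F q) (v 0)) := by
    have h5 : h (mulI n (v 1)) (v 0) = -h (mulI n (v 0)) (v 1) := by
      rw [hh.symm, hh.apply_mulI]
    have h6 : h (mulI n (v 0)) (v 1) = (h (mulI n (v 0)) (v 1) - h (mulI n (v 1)) (v 0)) / 2 := by
      rw [h5]; ring
    rw [h6, ← h2, ← h3, ← Finset.sum_sub_distrib, Finset.sum_div]
    refine Finset.sum_congr rfl fun r _ => ?_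
    rw [← Finset.sum_sub_distrib, Finset.sum_div]
    refine Finset.sum_congr rfl fun q _ => ?_
    ring
  rw [h4]
  simp only [ContinuousAlternatingMap.sum_apply, ContinuousAlternatingMap.smul_apply,
    flatWedge_apply, Matrix.det_fin_two, Complex.real_smul]
  push_cast
  simp

end Star

/-! ### The condition `d⋆Ω = 0` as a first-order equation on the metric. -/

section Balanced

variable {n : ℕ} {h₀ : Cn n →L[ℝ] Cn n →L[ℝ] ℝ} {F : Module.Basis (Fin n × Fin 2) ℝ (Cn n)}

/-- The coefficients of `⋆Ω` in a constant unitary frame of `h₀`, up to a constant. -/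
def starCoeff (h h₀ : Cn n →L[ℝ] Cn n →L[ℝ] ℝ) (F : Fin n × Fin 2 → Cn n)
    (r q : Fin n × Fin 2) : ℝ :=
  ∑ p, (Real.sqrt (gram h F).det * (gram h F)⁻¹ r p) * frameJ h₀ F q p

/-- `Jᵀ A` is the matrix of `Ω`, hence antisymmetric, and `A⁻¹ Jᵀ = A⁻¹ (Jᵀ A) A⁻¹` with `A⁻¹`
symmetric. -/
theorem starCoeff_antisymm {h : Cn n →L[ℝ] Cn n →L[ℝ] ℝ} (hh : IsHermitianForm h)
    (hF : IsUnitaryFrame h₀ F) (r q : Fin n × Fin 2) :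
    starCoeff h h₀ F r q = -starCoeff h h₀ F q r := by
  have hu := isUnit_iff_ne_zero.2 (hh.det_gram_pos F).ne'
  have h1 : ((frameJ h₀ F).transpose * gram h F).transpose =
      -((frameJ h₀ F).transpose * gram h F) := by
    have h2 : ∀ p q, ((frameJ h₀ F).transpose * gram h F) p q = h (mulI n (F p)) (F q) := by
      intro p q
      rw [Matrix.mul_apply, ← sum_frameJ_smul hF]
      simp [gram_apply, map_sum]
    ext p q
    rw [Matrix.transpose_apply, Matrix.neg_apply, h2, h2, hh.symm, hh.apply_mulI]
  have h2 : ((gram h F)⁻¹ * (frameJ h₀ F).transpose).transpose =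
      -((gram h F)⁻¹ * (frameJ h₀ F).transpose) := by
    have h3 : (gram h F)⁻¹ * (frameJ h₀ F).transpose =
        (gram h F)⁻¹ * ((frameJ h₀ F).transpose * gram h F) * (gram h F)⁻¹ := by
      rw [← mul_assoc, mul_assoc _ (gram h F), Matrix.mul_nonsing_inv _ hu, mul_one]
    rw [h3, Matrix.transpose_mul, Matrix.transpose_mul, h1, Matrix.transpose_nonsing_inv,
      hh.gram_transpose]
    simp [mul_assoc]
  have h3 : ∀ r q, starCoeff h h₀ F r q = Real.sqrt (gram h F).det *
      ((gram h F)⁻¹ * (frameJ h₀ F).transpose) r q := by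
    intro r q
    rw [starCoeff, Matrix.mul_apply, Finset.mul_sum]
    exact Finset.sum_congr rfl fun p _ => mul_assoc _ _ _
  have h4 := congrFun (congrFun h2 q) r
  rw [Matrix.transpose_apply, Matrix.neg_apply] at h4
  rw [h3, h3, h4, mul_neg]

theorem hodgeStar_fundamental {h : Cn n →L[ℝ] Cn n →L[ℝ] ℝ} (hh : IsHermitianForm h)
    (hF : IsUnitaryFrame h₀ F) {m : ℕ} (hm : 2 + m = 2 * n) (ε : Fin (m + 2) ≃ Fin n × Fin 2)
    {Ω : Covec n 2} (hΩ : ∀ v, Ω v = (h (mulI n (v 0)) (v 1) : ℂ)) :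
    hodgeStar hm h Ω = ∑ r, ∑ q, starCoeff h h₀ F r q •
      ((frameSign h₀ F hm ((finCongr (Nat.add_comm 2 m)).trans ε) / 2) •
        ((flatWedge h₀ (F ∘ ε)).curryLeft (F r)).curryLeft (F q)) := by
  ext v
  set κ := frameSign h₀ F hm ((finCongr (Nat.add_comm 2 m)).trans ε)
  have h1 : hodgeStar hm h Ω v =
      ∑ r, ∑ q, (((gram h F)⁻¹ * (frameJ h₀ F).transpose) r q / 2) •
        hodgeStar hm h (flatWedge h ![F r, F q]) v := by
    rw [hodgeStar_apply]
    conv_lhs => rw [fundamental_eq_sum_flatWedge hh hF hΩ]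
    change _ • wedgeRight 2 _ _ _ = _
    simp only [map_sum, map_smul, ContinuousAlternatingMap.sum_apply,
      ContinuousAlternatingMap.smul_apply, Finset.smul_sum]
    refine Finset.sum_congr rfl fun r _ => Finset.sum_congr rfl fun q _ => ?_
    rw [hodgeStar_apply, smul_comm]
    rfl
  rw [h1]
  simp only [ContinuousAlternatingMap.sum_apply, ContinuousAlternatingMap.smul_apply]
  refine Finset.sum_congr rfl fun r _ => Finset.sum_congr rfl fun q _ => ?_
  rw [hodgeStar_flatWedge hh hF hm ((finCongr (Nat.add_comm 2 m)).trans ε), append_eq_vecCons]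
  have h2 : (F ∘ (finCongr (Nat.add_comm 2 m)).trans ε : Fin (2 + m) → Cn n) =
      (F ∘ ε) ∘ Fin.cast (Nat.add_comm 2 m) := rfl
  rw [h2, flatWedge_comp_cast, smul_smul, smul_smul]
  change _ = _ • flatWedge h₀ (F ∘ ε) (Matrix.vecCons (F r) (Matrix.vecCons (F q) v))
  congr 1
  rw [starCoeff, Matrix.mul_apply, Finset.sum_div, Finset.sum_mul, Finset.sum_mul]
  refine Finset.sum_congr rfl fun p _ => ?_
  rw [Matrix.transpose_apply]
  ring

variable {U : Set (Cn n)} {h : Cn n → Cn n →L[ℝ] Cn n →L[ℝ] ℝ} {z : Cn n}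

theorem differentiableAt_sqrt_mul_inv (hh : IsHermitianForm (h z))
    (hd : DifferentiableAt ℝ h z) (p q : Fin n × Fin 2) :
    DifferentiableAt ℝ (fun y => Real.sqrt (gram (h y) F).det * (gram (h y) F)⁻¹ p q) z := by
  have hdet := hh.det_gram_pos F
  have hA : ∀ p q, DifferentiableAt ℝ (fun y => gram (h y) F p q) z := fun p q => by
    simp only [gram_apply]
    fun_prop
  exact ((differentiableAt_det hA).sqrt hdet.ne').mul (differentiableAt_inv hA hdet.ne' p q)

/-- The exterior derivative of a bivector contracted into a constant volume form is, up to a factor,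
its divergence contracted into that form, and a vector is determined by its contraction with a
volume form. -/
theorem sum_fderiv_starCoeff
    (hU : IsOpen U) (hz : z ∈ U) (hh : ∀ y ∈ U, IsHermitianForm (h y))
    (hd : DifferentiableAt ℝ h z) (hh₀ : IsHermitianForm h₀) (hF : IsUnitaryFrame h₀ F)
    {m : ℕ} (hm : 2 + m = 2 * n) {Ω : Cn n → Covec n 2}
    (hΩ : ∀ y ∈ U, ∀ v, Ω y v = (h y (mulI n (v 0)) (v 1) : ℂ))
    (hstar : extDeriv (fun y => hodgeStar hm (h y) (Ω y)) z = 0) (r : Fin n × Fin 2) :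
    ∑ q, fderiv ℝ (fun y => starCoeff (h y) h₀ F q r) z (F q) = 0 := by
  let ε : Fin (m + 2) ≃ Fin n × Fin 2 := (finCongr (by omega)).trans (pairEquiv n)
  let vol : Covec n (m + 2) := flatWedge h₀ (F ∘ ε)
  set κ := frameSign h₀ F hm ((finCongr (Nat.add_comm 2 m)).trans ε)
  have hκ0 : κ ≠ 0 := frameSign_ne_zero hh₀ hF _ _
  let l : Fin n × Fin 2 → Fin n × Fin 2 → Cn n →L[ℝ] ℝ :=
    fun r q => fderiv ℝ (fun y => starCoeff (h y) h₀ F r q) z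
  have hE : ∀ r q, DifferentiableAt ℝ (fun y => starCoeff (h y) h₀ F r q) z := by
    intro r q
    unfold starCoeff
    refine DifferentiableAt.fun_sum fun p _ => DifferentiableAt.mul_const ?_ _
    exact differentiableAt_sqrt_mul_inv (hh z hz) hd r p
  have h1 : (fun y => hodgeStar hm (h y) (Ω y)) =ᶠ[𝓝 z] fun y => ∑ r, ∑ q,
      starCoeff (h y) h₀ F r q • ((κ / 2) • (vol.curryLeft (F r)).curryLeft (F q)) := by
    filter_upwards [hU.mem_nhds hz] with y hy
    exact hodgeStar_fundamental (hh y hy) hF hm ε (hΩ y hy)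
  have h2 : HasFDerivAt (fun y => hodgeStar hm (h y) (Ω y))
      (∑ r, ∑ q, (l r q).smulRight ((κ / 2) • (vol.curryLeft (F r)).curryLeft (F q))) z :=
    (HasFDerivAt.fun_sum fun r _ => HasFDerivAt.fun_sum fun q _ =>
      (hE r q).hasFDerivAt.smul_const _).congr_of_eventuallyEq h1
  have hanti : ∀ r q, l r q = -l q r := by
    intro r q
    have : (fun y => starCoeff (h y) h₀ F r q) =ᶠ[𝓝 z] fun y => -starCoeff (h y) h₀ F q r := by
      filter_upwards [hU.mem_nhds hz] with y hy
      exact starCoeff_antisymm (hh y hy) hF r q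
    change fderiv ℝ _ z = -fderiv ℝ _ z
    rw [this.fderiv_eq, fderiv_fun_neg]
  have h3 : ∑ r, ∑ q, (l r q (F q) • F r - l r q (F r) • F q) = 0 := by
    refine eq_zero_of_contract_top (vol := vol) (F.reindex ε.symm) ?_ fun v => ?_
    · have : flatWedge h₀ (F ∘ ε) (F ∘ ε) = 1 := by
        rw [flatWedge_apply]
        have : (Matrix.of fun i j => h₀ ((F ∘ ε) i) ((F ∘ ε) j)) = 1 := by
          ext i j
          simp [hF.orthonormal, Matrix.one_apply]
        rw [this, Matrix.det_one, Complex.ofReal_one]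
      have h4 : ⇑(F.reindex ε.symm) = F ∘ ε := by
        funext i
        simp
      rw [h4]
      exact this ▸ one_ne_zero
    · have h4 := DFunLike.congr_fun hstar v
      rw [extDeriv, h2.fderiv, ContinuousAlternatingMap.alternatizeUncurryFin_apply] at h4
      simp only [_root_.sum_apply, ContinuousLinearMap.smulRight_apply,
        ContinuousAlternatingMap.sum_apply, ContinuousAlternatingMap.smul_apply,
        ContinuousAlternatingMap.curryLeft_apply_apply, Finset.smul_sum] at h4
      rw [Finset.sum_comm] at h4
      simp only [Finset.sum_comm (s := (Finset.univ : Finset (Fin (m + 1))))] at h4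
      have h5 : ∀ r q, ∑ i : Fin (m + 1), (-1 : ℤ) ^ (i : ℕ) • l r q (v i) • (κ / 2) •
          vol (Matrix.vecCons (F r) (Matrix.vecCons (F q) (i.removeNth v))) =
          (κ / 2) • (l r q (F q) • vol (Matrix.vecCons (F r) v) -
            l r q (F r) • vol (Matrix.vecCons (F q) v)) := by
        intro r q
        rw [← contract_top (by omega) vol, Finset.smul_sum]
        refine Finset.sum_congr rfl fun i _ => ?_
        simp only [Complex.real_smul, zsmul_eq_mul]
        ring
      change _ = (0 : ℂ) at h4
      have h6 : ∀ x, vol (Matrix.vecCons x v) = vol.curryLeft x v := fun x => rfl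
      simp only [h5, ← Finset.smul_sum] at h4
      have h7 := (smul_eq_zero.1 h4).resolve_left (by positivity)
      rw [h6, ← h7]
      simp only [h6, map_sum, map_sub, map_smul, ContinuousAlternatingMap.sum_apply,
        ContinuousAlternatingMap.sub_apply, ContinuousAlternatingMap.smul_apply]
  -- By antisymmetry of the coefficients the two terms agree after exchanging `r` and `q`, so they
  -- combine into minus twice the divergence.
  have h4 : ∑ r, ∑ q, (l r q (F q) • F r - l r q (F r) • F q) =
      ∑ r, (-2 * ∑ q, l q r (F q)) • F r := by
    simp only [Finset.sum_sub_distrib]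
    rw [Finset.sum_comm (f := fun r q => l r q (F r) • F q), ← Finset.sum_sub_distrib]
    refine Finset.sum_congr rfl fun r _ => ?_
    rw [← Finset.sum_smul, ← Finset.sum_smul, ← sub_smul]
    congr 1
    have : ∀ q, l r q (F q) = -l q r (F q) := fun q => by rw [hanti]; rfl
    simp only [this, Finset.sum_neg_distrib]
    ring
  rw [h4] at h3
  have h5 := Fintype.linearIndependent_iff.1 F.linearIndependent _ h3 r
  change ∑ q, l q r (F q) = 0
  linarith

/-- The trace form of the balanced condition `d ⋆ Ω = 0`. -/
theorem trace_eq_of_extDeriv_hodgeStar (hU : IsOpen U) (hz : z ∈ U)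
    (hh : ∀ y ∈ U, IsHermitianForm (h y)) (hd : DifferentiableAt ℝ h z)
    (hh₀ : IsHermitianForm h₀) (hF : IsUnitaryFrame h₀ F)
    {m : ℕ} (hm : 2 + m = 2 * n) {Ω : Cn n → Covec n 2}
    (hΩ : ∀ y ∈ U, ∀ v, Ω y v = (h y (mulI n (v 0)) (v 1) : ℂ))
    (hstar : extDeriv (fun y => hodgeStar hm (h y) (Ω y)) z = 0) (w : Fin n × Fin 2) :
    ∑ p, ∑ q, (gram (h z) F)⁻¹ p q *
      (fderiv ℝ h z (F w) (F p) (F q) - 2 * fderiv ℝ h z (F p) (F q) (F w)) = 0 := by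
  let Y : Fin n × Fin 2 → ℝ := fun p => ∑ q, fderiv ℝ
    (fun y => Real.sqrt (gram (h y) F).det * (gram (h y) F)⁻¹ q p) z (F q)
  have h1 : ∀ r, ∑ p, frameJ h₀ F r p * Y p = 0 := by
    intro r
    rw [← sum_fderiv_starCoeff hU hz hh hd hh₀ hF hm hΩ hstar r]
    simp only [Y, Finset.mul_sum]
    rw [Finset.sum_comm]
    refine Finset.sum_congr rfl fun q _ => ?_
    unfold starCoeff
    rw [fderiv_fun_sum fun p _ =>
      (differentiableAt_sqrt_mul_inv (hh z hz) hd q p).mul_const _]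
    simp only [fderiv_mul_const (differentiableAt_sqrt_mul_inv (hh z hz) hd q _),
      _root_.sum_apply, _root_.smul_apply, smul_eq_mul]
  -- The constant matrix of `J` comes out of the derivative; being invertible, it can be cancelled.
  have h2 : mulI n (∑ p, Y p • F p) = 0 := by
    have : ∀ r, h₀ (F r) (mulI n (∑ p, Y p • F p)) = 0 := by
      intro r
      rw [← h1 r]
      simp only [map_sum, map_smul, smul_eq_mul, frameJ, Matrix.of_apply]
      exact Finset.sum_congr rfl fun p _ => mul_comm _ _
    rw [← hF.sum_eq (mulI n _)]
    simp only [this, zero_smul, Finset.sum_const_zero]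
  have h3 : ∑ p, Y p • F p = 0 := by
    have := congrArg (mulI n) h2
    rwa [mulI_mulI, map_zero, neg_eq_zero] at this
  have h4 := Fintype.linearIndependent_iff.1 F.linearIndependent _ h3
  have hA : ∀ p q, HasFDerivAt (fun y => gram (h y) F p q)
      (fderiv ℝ (fun y => h y (F p) (F q)) z) z := fun p q =>
    DifferentiableAt.hasFDerivAt (by simp only [gram_apply]; fun_prop)
  have h5 := trace_eq_of_div_eq_zero hA ((hh z hz).gram_transpose F) ((hh z hz).det_gram_pos F)
    F h4 w
  simp only [fderiv_apply_apply hd] at h5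
  simp only [mul_sub, Finset.sum_sub_distrib, h5, Finset.mul_sum]
  rw [sub_eq_zero]
  refine Finset.sum_congr rfl fun p _ => Finset.sum_congr rfl fun q _ => ?_
  ring

end Balanced

section Instances

variable (n k : ℕ)

instance instNormedAddCommGroupBilin : NormedAddCommGroup (Cn n →L[ℝ] Cn n →L[ℝ] ℝ) :=
  ContinuousLinearMap.toNormedAddCommGroup (E := Cn n) (F := Cn n →L[ℝ] ℝ)

instance instNormedSpaceBilin : NormedSpace ℝ (Cn n →L[ℝ] Cn n →L[ℝ] ℝ) :=
  ContinuousLinearMap.toNormedSpace (E := Cn n) (F := Cn n →L[ℝ] ℝ)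

instance instAddCommGroupBilin : AddCommGroup (Cn n →L[ℝ] Cn n →L[ℝ] ℝ) :=
  (instNormedAddCommGroupBilin n).toAddCommGroup

instance instNormedAddCommGroupCovecOne : NormedAddCommGroup (Cn n →L[ℝ] Covec n k) :=
  ContinuousLinearMap.toNormedAddCommGroup (E := Cn n) (F := Covec n k)

instance instNormedSpaceCovecOne : NormedSpace ℝ (Cn n →L[ℝ] Covec n k) :=
  ContinuousLinearMap.toNormedSpace (E := Cn n) (F := Covec n k)

end Instances

/-! ### First and second derivatives of `Ω`, and `∂∂̄Ω` in coordinates. -/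

section SecondOrder

variable {n : ℕ}

/-- The antisymmetrization of `(v, w) ↦ b(i v, w)`. For a Hermitian form `b` it is the fundamental
form. -/
def fundamentalCovec (b : Cn n →L[ℝ] Cn n →L[ℝ] ℝ) : Covec n 2 :=
  (1 / 2 : ℝ) • ContinuousAlternatingMap.alternatizeUncurryFin
    (((ContinuousAlternatingMap.ofSubsingletonLIE (𝕜 := ℝ) (E := Cn n) (F := ℂ)
      (0 : Fin 1)).toContinuousLinearEquiv.toContinuousLinearMap.comp
      (ContinuousLinearMap.compL ℝ (Cn n) ℝ ℂ Complex.ofRealCLM)).comp (b.comp (mulI n)))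

theorem fundamentalCovec_apply (b : Cn n →L[ℝ] Cn n →L[ℝ] ℝ) (v : Fin 2 → Cn n) :
    fundamentalCovec b v = ((b (mulI n (v 0)) (v 1) - b (mulI n (v 1)) (v 0) : ℝ) : ℂ) / 2 := by
  rw [fundamentalCovec,
    ContinuousAlternatingMap.smul_apply, ContinuousAlternatingMap.alternatizeUncurryFin_apply,
    Fin.sum_univ_two]
  simp [-mulI_apply, Fin.removeNth, Fin.tail]
  ring

/-- `fundamentalCovec` as a continuous linear map. -/
def fundamentalCLM (n : ℕ) : (Cn n →L[ℝ] Cn n →L[ℝ] ℝ) →L[ℝ] Covec n 2 :=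
  LinearMap.toContinuousLinearMap
    { toFun := fundamentalCovec
      map_add' := fun a b => by
        ext v
        simp only [ContinuousAlternatingMap.add_apply, fundamentalCovec_apply, _root_.add_apply]
        push_cast
        ring
      map_smul' := fun c b => by
        ext v
        simp only [ContinuousAlternatingMap.smul_apply, fundamentalCovec_apply, _root_.smul_apply,
          RingHom.id_apply, smul_eq_mul, Complex.real_smul]
        push_cast
        ring }

theorem fundamentalCLM_apply (b : Cn n →L[ℝ] Cn n →L[ℝ] ℝ) (v : Fin 2 → Cn n) :
    fundamentalCLM n b v = ((b (mulI n (v 0)) (v 1) - b (mulI n (v 1)) (v 0) : ℝ) : ℂ) / 2 :=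
  fundamentalCovec_apply b v

/-- The invariance properties of (the derivatives of) a Hermitian form. -/
structure IsHermitianSymm (b : Cn n →L[ℝ] Cn n →L[ℝ] ℝ) : Prop where
  symm : ∀ v w, b v w = b w v
  mulI_mulI : ∀ v w, b (mulI n v) (mulI n w) = b v w

namespace IsHermitianSymm

variable {b : Cn n →L[ℝ] Cn n →L[ℝ] ℝ}

theorem apply_mulI (hb : IsHermitianSymm b) (v w : Cn n) : b v (mulI n w) = -b (mulI n v) w := by
  rw [← hb.mulI_mulI v, HermitianGeometry.mulI_mulI, map_neg]

theorem fundamentalCLM_apply (hb : IsHermitianSymm b) (v : Fin 2 → Cn n) :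
    fundamentalCLM n b v = (b (mulI n (v 0)) (v 1) : ℂ) := by
  rw [HermitianGeometry.fundamentalCLM_apply, hb.symm (mulI n (v 1)), hb.apply_mulI]
  push_cast
  ring

theorem fderiv {h : Cn n → Cn n →L[ℝ] Cn n →L[ℝ] ℝ} {z : Cn n}
    (hd : DifferentiableAt ℝ h z) (hh : ∀ᶠ y in 𝓝 z, IsHermitianSymm (h y)) (u : Cn n) :
    IsHermitianSymm (fderiv ℝ h z u) where
  symm v w := by
    rw [← fderiv_apply_apply hd, ← fderiv_apply_apply hd]
    congr 1
    exact Filter.EventuallyEq.fderiv_eq (hh.mono fun y hy => hy.symm v w)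
  mulI_mulI v w := by
    rw [← fderiv_apply_apply hd, ← fderiv_apply_apply hd]
    congr 1
    exact Filter.EventuallyEq.fderiv_eq (hh.mono fun y hy => hy.mulI_mulI v w)

end IsHermitianSymm

theorem fderiv_covec_apply {k : ℕ} {α : Cn n → Covec n k} {z : Cn n}
    (hα : DifferentiableAt ℝ α z) (u : Cn n) (v : Fin k → Cn n) :
    fderiv ℝ α z u v = fderiv ℝ (fun y => α y v) z u := by
  have := ((ContinuousAlternatingMap.apply ℝ (Cn n) ℂ v).hasFDerivAt.comp z
    hα.hasFDerivAt).fderiv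
  exact (DFunLike.congr_fun this u).symm

variable {U : Set (Cn n)} {h : Cn n → Cn n →L[ℝ] Cn n →L[ℝ] ℝ} {z : Cn n} {Ω : Cn n → Covec n 2}

/-- `Ω` depends on the metric through a fixed linear map, because `J` is constant, so
differentiation passes through it. -/
theorem fderiv_fundamental (hd : DifferentiableAt ℝ h z)
    (hΩ : Ω =ᶠ[𝓝 z] fun y => fundamentalCLM n (h y)) :
    fderiv ℝ Ω z = (fundamentalCLM n).comp (fderiv ℝ h z) := by
  rw [hΩ.fderiv_eq]
  exact ((fundamentalCLM n).hasFDerivAt.comp z hd.hasFDerivAt).fderiv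

theorem antilinPart_apply {k : ℕ} (A : Cn n →L[ℝ] Covec n k) (u : Cn n) (v : Fin k → Cn n) :
    antilinPart A u v = (A u v + Complex.I * A (mulI n u) v) / 2 := by
  simp [antilinPart]
  ring

theorem linPart_apply {k : ℕ} (A : Cn n →L[ℝ] Covec n k) (u : Cn n) (v : Fin k → Cn n) :
    linPart A u v = (A u v - Complex.I * A (mulI n u) v) / 2 := by
  simp [linPart]
  ring

theorem vec_three_removeNth {α : Type*} (a b c : α) :
    (0 : Fin 3).removeNth ![a, b, c] = ![b, c] ∧ (1 : Fin 3).removeNth ![a, b, c] = ![a, c] ∧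
      (2 : Fin 3).removeNth ![a, b, c] = ![a, b] := by
  refine ⟨?_, ?_, ?_⟩ <;> (funext i; fin_cases i <;> rfl)

theorem vec_four_removeNth {α : Type*} (a b c d : α) :
    (0 : Fin 4).removeNth ![a, b, c, d] = ![b, c, d] ∧
      (1 : Fin 4).removeNth ![a, b, c, d] = ![a, c, d] ∧
      (2 : Fin 4).removeNth ![a, b, c, d] = ![a, b, d] ∧
      (3 : Fin 4).removeNth ![a, b, c, d] = ![a, b, c] := by
  refine ⟨?_, ?_, ?_, ?_⟩ <;> (funext i; fin_cases i <;> rfl)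

theorem delbar_fundamental_apply (hd : DifferentiableAt ℝ h z)
    (hh : ∀ᶠ y in 𝓝 z, IsHermitianSymm (h y))
    (hΩ : Ω =ᶠ[𝓝 z] fun y => fundamentalCLM n (h y)) (a b c : Cn n) :
    delbar Ω z ![a, b, c] =
      ((fderiv ℝ h z a (mulI n b) c + Complex.I * fderiv ℝ h z (mulI n a) (mulI n b) c) -
      (fderiv ℝ h z b (mulI n a) c + Complex.I * fderiv ℝ h z (mulI n b) (mulI n a) c) +
      (fderiv ℝ h z c (mulI n a) b + Complex.I * fderiv ℝ h z (mulI n c) (mulI n a) b)) / 2 := by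
  obtain ⟨h0, h1, h2⟩ := vec_three_removeNth a b c
  rw [delbar, ContinuousAlternatingMap.alternatizeUncurryFin_apply, Fin.sum_univ_three, h0, h1, h2,
    fderiv_fundamental hd hΩ]
  simp only [antilinPart_apply, ContinuousLinearMap.comp_apply,
    (IsHermitianSymm.fderiv hd hh _).fundamentalCLM_apply]
  simp [-mulI_apply]
  ring

theorem differentiableAt_delbar {k : ℕ} {α : Cn n → Covec n k}
    (hα : DifferentiableAt ℝ (fderiv ℝ α) z) : DifferentiableAt ℝ (delbar α) z := by
  have h1 : DifferentiableAt ℝ (fun y => antilinPart (fderiv ℝ α y)) z := by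
    have h2 : DifferentiableAt ℝ (fun y => (fderiv ℝ α y).comp (mulI n)) z :=
      hα.clm_comp (differentiableAt_const _)
    have h3 := hα.fun_add (h2.fun_const_smul Complex.I)
    exact h3.fun_const_smul (1 / 2 : ℂ)
  exact (ContinuousAlternatingMap.alternatizeUncurryFinCLM ℝ (Cn n) ℂ).differentiableAt.comp z h1

/-- The coordinate expression of `∂∂̄Ω` in terms of the second derivatives
`K x y a b = D²h(x, y)(i a, b)`. -/
theorem del_delbar_fundamental_apply (hh : ∀ᶠ y in 𝓝 z, IsHermitianSymm (h y))
    (hsm : ContDiffAt ℝ ∞ h z) (hd : ∀ᶠ y in 𝓝 z, DifferentiableAt ℝ h y)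
    (hΩ : ∀ᶠ y in 𝓝 z, Ω y = fundamentalCLM n (h y)) (K : Cn n → Cn n → Cn n → Cn n → ℂ)
    (hK : ∀ x y a b, K x y a b = (fderiv ℝ (fderiv ℝ h) z x y (mulI n a) b : ℂ))
    (a b c d : Cn n) :
    del (delbar Ω) z ![a, b, c, d] = Complex.I / 2 *
      ((K a (mulI n b) c d - K (mulI n a) b c d) - (K a (mulI n c) b d - K (mulI n a) c b d) +
        (K a (mulI n d) b c - K (mulI n a) d b c) + (K b (mulI n c) a d - K (mulI n b) c a d) -
        (K b (mulI n d) a c - K (mulI n b) d a c) +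
        (K c (mulI n d) a b - K (mulI n c) d a b)) := by
  have hd2 : DifferentiableAt ℝ (fderiv ℝ h) z :=
    (hsm.fderiv_right (m := 1) (by norm_num; exact ENat.LEInfty.out)).differentiableAt (by simp)
  have hdΩ : DifferentiableAt ℝ (fderiv ℝ Ω) z := by
    have h1 : DifferentiableAt ℝ (fun y => (fundamentalCLM n).comp (fderiv ℝ h y)) z :=
      (differentiableAt_const _).clm_comp hd2
    refine h1.congr_of_eventuallyEq ?_
    filter_upwards [hd, hΩ.eventually_nhds] with y hy hy2
    exact fderiv_fundamental hy hy2
  have hdelbar : ∀ u a b c, fderiv ℝ (delbar Ω) z u ![a, b, c] =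
      ((K u a b c + Complex.I * K u (mulI n a) b c) - (K u b a c + Complex.I * K u (mulI n b) a c) +
      (K u c a b + Complex.I * K u (mulI n c) a b)) / 2 := by
    intro u a b c
    rw [fderiv_covec_apply (differentiableAt_delbar hdΩ)]
    have h1 : (fun y => delbar Ω y ![a, b, c]) =ᶠ[𝓝 z] fun y =>
        ((fderiv ℝ h y a (mulI n b) c + Complex.I * fderiv ℝ h y (mulI n a) (mulI n b) c) -
        (fderiv ℝ h y b (mulI n a) c + Complex.I * fderiv ℝ h y (mulI n b) (mulI n a) c) +
        (fderiv ℝ h y c (mulI n a) b + Complex.I * fderiv ℝ h y (mulI n c) (mulI n a) b)) / 2 := by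
      filter_upwards [hd, hΩ.eventually_nhds, hh.eventually_nhds] with y hy hy2 hy3
      exact delbar_fundamental_apply hy hy3 hy2 a b c
    have hdq : ∀ x a b, DifferentiableAt ℝ (fun y => fderiv ℝ h y x (mulI n a) b) z :=
      fun x a b => ((hd2.clm_apply (differentiableAt_const x)).clm_apply
        (differentiableAt_const (mulI n a))).clm_apply (differentiableAt_const b)
    have hq : ∀ x a b, HasFDerivAt (fun y => (fderiv ℝ h y x (mulI n a) b : ℂ))
        (Complex.ofRealCLM.comp (fderiv ℝ (fun y => fderiv ℝ h y x (mulI n a) b) z)) z :=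
      fun x a b => Complex.ofRealCLM.hasFDerivAt.comp z (hdq x a b).hasFDerivAt
    have hq2 : ∀ x a b, Complex.ofRealCLM.comp
        (fderiv ℝ (fun y => fderiv ℝ h y x (mulI n a) b) z) u = K u x a b := by
      intro x a b
      have h2 : DifferentiableAt ℝ (fun y => fderiv ℝ h y x) z := by fun_prop
      rw [hK, ContinuousLinearMap.comp_apply, fderiv_apply_apply h2]
      have h3 : fderiv ℝ (fun y => fderiv ℝ h y x) z u = fderiv ℝ (fderiv ℝ h) z u x := by
        rw [fderiv_clm_apply hd2 (differentiableAt_const x)]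
        simp
      rw [h3]
      rfl
    have h2 := (((((hq a b c).add ((hq (mulI n a) b c).const_mul Complex.I)).sub
      ((hq b a c).add ((hq (mulI n b) a c).const_mul Complex.I))).add
      ((hq c a b).add ((hq (mulI n c) a b).const_mul Complex.I)))).mul_const (2 : ℂ)⁻¹
    have h3 := (h2.congr_of_eventuallyEq (h1.trans (Filter.Eventually.of_forall fun y => by
      simp only [Pi.add_apply, Pi.sub_apply, div_eq_mul_inv]))).fderiv
    rw [h3]
    simp only [_root_.add_apply, _root_.sub_apply, _root_.smul_apply, hq2, smul_eq_mul,
      div_eq_mul_inv]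
    ring
  have hsymm : ∀ x y, ∀ a b, K x y a b = K y x a b := by
    intro x y a b
    have := (hsm.isSymmSndFDerivAt (by simpa using ENat.LEInfty.out)).eq x y
    rw [hK, hK, this]
  obtain ⟨h0, h1, h2, h3⟩ := vec_four_removeNth a b c d
  rw [del, ContinuousAlternatingMap.alternatizeUncurryFin_apply, Fin.sum_univ_four, h0, h1, h2, h3]
  simp only [linPart_apply, hdelbar]
  have hI := Complex.I_mul_I
  simp [-mulI_apply]
  -- Ordering the two differentiation directions cancels, under antisymmetrization, the parts `D²(u,
  -- v)` and `D²(iu, iv)`. Only `D²(u, iv) - D²(iu, v)` survives.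
  simp only [hsymm b a, hsymm c a, hsymm d a, hsymm c b, hsymm d b, hsymm d c,
    hsymm (mulI n b) a, hsymm (mulI n c) a, hsymm (mulI n d) a, hsymm (mulI n c) b,
    hsymm (mulI n d) b, hsymm (mulI n d) c, hsymm b (mulI n a), hsymm c (mulI n a),
    hsymm d (mulI n a), hsymm c (mulI n b), hsymm d (mulI n b), hsymm d (mulI n c),
    hsymm (mulI n b) (mulI n a), hsymm (mulI n c) (mulI n a), hsymm (mulI n d) (mulI n a),
    hsymm (mulI n c) (mulI n b), hsymm (mulI n d) (mulI n b), hsymm (mulI n d) (mulI n c)]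
  ring_nf

end SecondOrder

/-! ### The double trace of `∂∂̄Ω` and the norm of `dΩ`. -/

section Local

variable {n : ℕ} {F : Module.Basis (Fin n × Fin 2) ℝ (Cn n)} {h₀ : Cn n →L[ℝ] Cn n →L[ℝ] ℝ}

/-- Multiplication by `i` permutes the frame up to signs, which an even function does not see. -/
theorem IsUnitaryFrame.sum_mulI (hF : IsUnitaryFrame h₀ F) {g : Cn n → ℝ}
    (hg : ∀ v, g (-v) = g v) : ∑ p, g (mulI n (F p)) = ∑ p, g (F p) := by
  rw [Fintype.sum_prod_type, Fintype.sum_prod_type]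
  refine Finset.sum_congr rfl fun j _ => ?_
  rw [Fin.sum_univ_two, Fin.sum_univ_two, hF.mulI_fst, hF.mulI_snd, hg, add_comm]

theorem IsUnitaryFrame.gram_eq_one (hF : IsUnitaryFrame h₀ F) : gram h₀ F = 1 := by
  ext p q
  rw [gram_apply, hF.orthonormal, Matrix.one_apply]

/-- The vanishing of `|dΩ|²`, expressed through the first derivatives of the metric, forces
`dΩ = 0`. -/
theorem cyclic_sum_eq_zero (hF : IsUnitaryFrame h₀ F)
    {T : Cn n →L[ℝ] Cn n →L[ℝ] Cn n →L[ℝ] ℝ} (hT : ∀ u, IsHermitianSymm (T u))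
    (h0 : ∑ x, ∑ y, ∑ w, T (F x) (F y) (F w) * (T (F x) (F y) (F w) - 2 * T (F y) (F w) (F x)) = 0)
    (x y w : Fin n × Fin 2) :
    T (F x) (mulI n (F y)) (F w) + T (F y) (mulI n (F w)) (F x) +
      T (F w) (mulI n (F x)) (F y) = 0 := by
  let S : Fin n × Fin 2 → Fin n × Fin 2 → Fin n × Fin 2 → ℝ :=
    fun x y w => T (F x) (mulI n (F y)) (F w)
  have hsq : ∑ x, ∑ y, ∑ w, S x y w ^ 2 = ∑ x, ∑ y, ∑ w, T (F x) (F y) (F w) ^ 2 := by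
    refine Finset.sum_congr rfl fun x _ => ?_
    exact hF.sum_mulI (g := fun v => ∑ w, T (F x) v (F w) ^ 2) fun v => by simp
  -- Moving `i` from `y` to `w` in the first factor costs a sign. Then `i w` occurs in both factors,
  -- and the substitution `w ↦ i w` over the frame removes it.
  have hcross : ∑ x, ∑ y, ∑ w, S x y w * S y w x =
      -∑ x, ∑ y, ∑ w, T (F x) (F y) (F w) * T (F y) (F w) (F x) := by
    rw [← Finset.sum_neg_distrib]
    refine Finset.sum_congr rfl fun x _ => ?_
    rw [← Finset.sum_neg_distrib]
    refine Finset.sum_congr rfl fun y _ => ?_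
    rw [← hF.sum_mulI (g := fun v => T (F x) (F y) v * T (F y) v (F x)) fun v => by simp,
      ← Finset.sum_neg_distrib]
    refine Finset.sum_congr rfl fun w _ => ?_
    have := (hT (F x)).apply_mulI (F y) (F w)
    simp only [S, this]
    ring
  have hrot : ∀ f : Fin n × Fin 2 → Fin n × Fin 2 → Fin n × Fin 2 → ℝ,
      ∑ x, ∑ y, ∑ w, f y w x = ∑ x, ∑ y, ∑ w, f x y w := by
    intro f
    rw [Finset.sum_comm]
    exact Finset.sum_congr rfl fun y _ => Finset.sum_comm
  -- The bracket is `dΩ` on frame vectors. Its expansion has three equal square sums and three equal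
  -- cross sums, which gives three times `h0`.
  have hsum : ∑ x, ∑ y, ∑ w, (S x y w + S y w x + S w x y) ^ 2 = 0 := by
    have h1 : ∀ x y w, (S x y w + S y w x + S w x y) ^ 2 =
        S x y w ^ 2 + S y w x ^ 2 + S w x y ^ 2 +
        2 * (S x y w * S y w x) + 2 * (S y w x * S w x y) + 2 * (S w x y * S x y w) := by
      intro x y w
      ring
    simp only [h1, Finset.sum_add_distrib, ← Finset.mul_sum]
    rw [hrot fun x y w => S x y w ^ 2, ← hrot fun x y w => S w x y ^ 2,
      hrot fun x y w => S x y w * S y w x, ← hrot fun x y w => S w x y * S x y w, hsq, hcross]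
    simp only [mul_sub, Finset.sum_sub_distrib] at h0
    simp only [mul_left_comm _ (2 : ℝ), ← Finset.mul_sum, ← sq] at h0
    linear_combination 3 * h0
  have h1 := (Finset.sum_eq_zero_iff_of_nonneg fun x _ => Finset.sum_nonneg fun y _ =>
    Finset.sum_nonneg fun w _ => sq_nonneg _).1 hsum x (Finset.mem_univ _)
  have h2 := (Finset.sum_eq_zero_iff_of_nonneg fun y _ =>
    Finset.sum_nonneg fun w _ => sq_nonneg _).1 h1 y (Finset.mem_univ _)
  have h3 := (Finset.sum_eq_zero_iff_of_nonneg fun w _ => sq_nonneg _).1 h2 w (Finset.mem_univ _)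
  exact pow_eq_zero_iff two_ne_zero |>.1 h3

variable {h : Cn n → Cn n →L[ℝ] Cn n →L[ℝ] ℝ} {z : Cn n}

/-- The double trace of `∂∂̄Ω` in terms of the second derivatives of the metric. -/
theorem double_trace_eq_zero (hF : IsUnitaryFrame h₀ F)
    {D : Cn n → Cn n → Cn n →L[ℝ] Cn n →L[ℝ] ℝ} (hD : ∀ u v, IsHermitianSymm (D u v))
    (hneg : ∀ u v, D (-u) v = -D u v) (hneg' : ∀ u v, D u (-v) = -D u v)
    {β : Covec n 4} {K : Cn n → Cn n → Cn n → Cn n → ℂ}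
    (hK : ∀ x y a b, K x y a b = (D x y (mulI n a) b : ℂ))
    (hβ : ∀ a b c d, β ![a, b, c, d] = Complex.I / 2 *
      ((K a (mulI n b) c d - K (mulI n a) b c d) - (K a (mulI n c) b d - K (mulI n a) c b d) +
        (K a (mulI n d) b c - K (mulI n a) d b c) + (K b (mulI n c) a d - K (mulI n b) c a d) -
        (K b (mulI n d) a c - K (mulI n b) d a c) +
        (K c (mulI n d) a b - K (mulI n c) d a b)))
    (h0 : ∑ a, ∑ b, β ![F (a, 0), F (a, 1), F (b, 0), F (b, 1)] = 0) :
    ∑ p, ∑ q, (D (F p) (F p) (F q) (F q) - 2 * D (F p) (F q) (F p) (F q)) = 0 := by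
  -- `P` and `Z` collect the pure and mixed second derivatives over a pair of complex lines, with
  -- `J`-invariance reducing them to independent entries.
  let P : Fin n → Fin n → ℝ := fun a b =>
    2 * (D (F (a, 0)) (F (a, 0)) (F (b, 0)) (F (b, 0)) +
      D (F (a, 1)) (F (a, 1)) (F (b, 0)) (F (b, 0)))
  let Z : Fin n → Fin n → ℝ := fun a b =>
    D (F (a, 0)) (F (b, 0)) (F (a, 0)) (F (b, 0)) + D (F (a, 1)) (F (b, 1)) (F (a, 0)) (F (b, 0)) +
    D (F (a, 0)) (F (b, 1)) (F (a, 0)) (F (b, 1)) - D (F (a, 1)) (F (b, 0)) (F (a, 0)) (F (b, 1))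
  have h11 : ∀ u v a b, D u v (F (a, 1)) (F (b, 1)) = D u v (F (a, 0)) (F (b, 0)) := by
    intro u v a b
    rw [← hF.mulI_fst, ← hF.mulI_fst, (hD u v).mulI_mulI]
  have h10 : ∀ u v a b, D u v (F (a, 1)) (F (b, 0)) = -D u v (F (a, 0)) (F (b, 1)) := by
    intro u v a b
    rw [← hF.mulI_fst, ← hF.mulI_fst, (hD u v).apply_mulI, neg_neg]
  have hsum : ∑ p, ∑ q, (D (F p) (F p) (F q) (F q) - 2 * D (F p) (F q) (F p) (F q)) =
      ∑ a, ∑ b, (P a b - 2 * Z a b) := by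
    rw [Fintype.sum_prod_type]
    refine Finset.sum_congr rfl fun a _ => ?_
    rw [Fin.sum_univ_two, Fintype.sum_prod_type, Fintype.sum_prod_type, ← Finset.sum_add_distrib]
    refine Finset.sum_congr rfl fun b _ => ?_
    simp only [Fin.sum_univ_two, P, Z, h11, h10]
    ring
  have hX : ∀ a b, β ![F (a, 0), F (a, 1), F (b, 0), F (b, 1)] =
      Complex.I / 2 * ((-(P a b + P b a) / 2 + 2 * Z a b : ℝ) : ℂ) := by
    intro a b
    rw [hβ]
    congr 1
    simp only [hK, hF.mulI_fst, hF.mulI_snd, hneg, hneg', neg_apply, map_neg]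
    simp only [P, Z, h11, h10]
    push_cast
    ring
  have h1 : ∑ a, ∑ b, (-(P a b + P b a) / 2 + 2 * Z a b) = 0 := by
    simp only [hX, ← Finset.mul_sum, ← Complex.ofReal_sum] at h0
    have := (mul_eq_zero.1 h0).resolve_left (by simp)
    exact_mod_cast this
  have h2 : ∑ a, ∑ b, P b a = ∑ a, ∑ b, P a b := Finset.sum_comm
  rw [hsum]
  simp only [Finset.sum_add_distrib, Finset.sum_sub_distrib, ← Finset.sum_div,
    Finset.sum_neg_distrib, ← Finset.mul_sum, h2] at h1 ⊢
  linarith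

/-- The derivative of the trace form of the balanced condition. -/
theorem deriv_trace_balanced (hF : IsUnitaryFrame (h z) F) (hd : DifferentiableAt ℝ h z)
    (hd2 : DifferentiableAt ℝ (fderiv ℝ h) z) (w : Fin n × Fin 2)
    (hτ : ∀ᶠ y in 𝓝 z, ∑ p, ∑ q, (gram (h y) F)⁻¹ p q *
      (fderiv ℝ h y (F w) (F p) (F q) - 2 * fderiv ℝ h y (F p) (F q) (F w)) = 0) :
    ∑ p, (fderiv ℝ (fderiv ℝ h) z (F w) (F w) (F p) (F p) -
        2 * fderiv ℝ (fderiv ℝ h) z (F w) (F p) (F p) (F w)) =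
      ∑ p, ∑ q, fderiv ℝ h z (F w) (F p) (F q) *
        (fderiv ℝ h z (F w) (F p) (F q) - 2 * fderiv ℝ h z (F p) (F q) (F w)) := by
  have hg : gram (h z) F = 1 := hF.gram_eq_one
  have hdet : (gram (h z) F).det ≠ 0 := by rw [hg, Matrix.det_one]; exact one_ne_zero
  have hA : ∀ p q, HasFDerivAt (fun y => gram (h y) F p q)
      (fderiv ℝ (fun y => h y (F p) (F q)) z) z := fun p q =>
    DifferentiableAt.hasFDerivAt (by simp only [gram_apply]; fun_prop)
  have hB := differentiableAt_inv (fun p q => (hA p q).differentiableAt) hdet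
  have ht : ∀ u a b, HasFDerivAt (fun y => fderiv ℝ h y u a b)
      (fderiv ℝ (fun y => fderiv ℝ h y u a b) z) z := fun u a b =>
    (((hd2.clm_apply (differentiableAt_const u)).clm_apply
        (differentiableAt_const a)).clm_apply (differentiableAt_const b)).hasFDerivAt
  have ht2 : ∀ u a b v, fderiv ℝ (fun y => fderiv ℝ h y u a b) z v =
      fderiv ℝ (fderiv ℝ h) z v u a b := by
    intro u a b v
    have h2 : DifferentiableAt ℝ (fun y => fderiv ℝ h y u) z :=
      hd2.clm_apply (differentiableAt_const u)
    rw [fderiv_apply_apply h2, fderiv_clm_apply hd2 (differentiableAt_const u)]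
    simp
  have h1 := HasFDerivAt.fun_sum (u := Finset.univ) fun p _ =>
    HasFDerivAt.fun_sum (u := Finset.univ) fun q _ =>
    (hB p q).hasFDerivAt.fun_mul ((ht (F w) (F p) (F q)).fun_sub ((ht (F p) (F q) (F w)).const_mul 2))
  -- The product rule yields second derivatives plus a term from the derivative of `A⁻¹`. Since `A =
  -- 1` at `z`, the latter is minus the derivative of `A`, which produces the quadratic right side.
  have h2 := h1.unique ((hasFDerivAt_const (0 : ℝ) z).congr_of_eventuallyEq hτ)
  have h3 := DFunLike.congr_fun h2 (F w)
  simp only [_root_.sum_apply, _root_.add_apply, _root_.sub_apply, _root_.smul_apply, smul_eq_mul,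
    ht2, fderiv_inv hA hdet, hg, inv_one, _root_.zero_apply, fderiv_apply_apply hd,
    Finset.sum_add_distrib] at h3
  have h4 : ∀ p q, ∑ r, ∑ s, (1 : Matrix (Fin n × Fin 2) (Fin n × Fin 2) ℝ) p r *
      fderiv ℝ h z (F w) (F r) (F s) * (1 : Matrix (Fin n × Fin 2) (Fin n × Fin 2) ℝ) s q =
        fderiv ℝ h z (F w) (F p) (F q) := by
    intro p q
    simp [Matrix.one_apply]
  simp only [h4] at h3
  have h5 : ∀ p, ∑ q, (1 : Matrix (Fin n × Fin 2) (Fin n × Fin 2) ℝ) p q *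
      (fderiv ℝ (fderiv ℝ h) z (F w) (F w) (F p) (F q) -
        2 * fderiv ℝ (fderiv ℝ h) z (F w) (F p) (F q) (F w)) =
      fderiv ℝ (fderiv ℝ h) z (F w) (F w) (F p) (F p) -
        2 * fderiv ℝ (fderiv ℝ h) z (F w) (F p) (F p) (F w) := by
    intro p
    simp [Matrix.one_apply]
  simp only [h5] at h3
  rw [← sub_eq_zero, ← h3, sub_eq_add_neg, ← Finset.sum_neg_distrib]
  congr 1
  refine Finset.sum_congr rfl fun p _ => ?_
  rw [← Finset.sum_neg_distrib]
  refine Finset.sum_congr rfl fun q _ => ?_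
  ring

end Local

/-! ### Assembly of the local theorem and passage to the manifold. -/

theorem IsHermitianForm.isHermitianSymm {n : ℕ} {h : Cn n →L[ℝ] Cn n →L[ℝ] ℝ}
    (hh : IsHermitianForm h) : IsHermitianSymm h :=
  ⟨hh.symm, hh.mulI_mulI⟩

theorem covecJ_eq_zero {n k : ℕ} {α : Covec n k} (hα : covecJ α = 0) : α = 0 := by
  ext v
  have h1 := DFunLike.congr_fun hα fun i => -mulI n (v i)
  have h2 : covecJ α (fun i => -mulI n (v i)) = α fun i => mulI n (-mulI n (v i)) := rfl
  rw [h2] at h1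
  simp only [map_neg, mulI_mulI, neg_neg] at h1
  exact h1

/-- A balanced and first Gauduchon Hermitian metric on an open subset of `ℂⁿ` is Kähler. -/
theorem extDeriv_fundamental_eq_zero {n : ℕ} (hn : 2 ≤ n) {U : Set (Cn n)} (hU : IsOpen U)
    {h : Cn n → Cn n →L[ℝ] Cn n →L[ℝ] ℝ} (hsm : ContDiffOn ℝ ∞ h U)
    (hh : ∀ y ∈ U, IsHermitianForm (h y)) {Ω : Cn n → Covec n 2}
    (hΩ : ∀ y ∈ U, ∀ v, Ω y v = (h y (mulI n (v 0)) (v 1) : ℂ)) {m : ℕ} (hm : 2 + m = 2 * n)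
    (hG : ∀ y ∈ U, wedge (del (delbar Ω) y) (wedgePow (Ω y) (n - 2)) = 0)
    (hB : ∀ y ∈ U, extDeriv (fun y => hodgeStar hm (h y) (Ω y)) y = 0)
    {z : Cn n} (hz : z ∈ U) : extDeriv Ω z = 0 := by
  obtain ⟨F, hF⟩ := (hh z hz).exists_isUnitaryFrame
  have hsmz : ContDiffAt ℝ ∞ h z := hsm.contDiffAt (hU.mem_nhds hz)
  have hd : ∀ y ∈ U, DifferentiableAt ℝ h y := fun y hy =>
    (hsm.contDiffAt (hU.mem_nhds hy)).differentiableAt (by simp)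
  have hd2 : DifferentiableAt ℝ (fderiv ℝ h) z :=
    (hsmz.fderiv_right (m := 1) (by norm_num; exact ENat.LEInfty.out)).differentiableAt (by simp)
  have hΩ' : ∀ y ∈ U, Ω y = fundamentalCLM n (h y) := fun y hy => by
    ext v
    rw [hΩ y hy, (hh y hy).isHermitianSymm.fundamentalCLM_apply]
  have hev : ∀ {p : Cn n → Prop}, (∀ y ∈ U, p y) → ∀ᶠ y in 𝓝 z, p y := fun hp =>
    Filter.mem_of_superset (hU.mem_nhds hz) hp
  have hsymm : ∀ y ∈ U, ∀ u, IsHermitianSymm (fderiv ℝ h y u) := fun y hy u =>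
    IsHermitianSymm.fderiv (hd y hy)
      (Filter.mem_of_superset (hU.mem_nhds hy) fun x hx => (hh x hx).isHermitianSymm) u
  have hD2 : ∀ u v, IsHermitianSymm (fderiv ℝ (fderiv ℝ h) z u v) := by
    intro u v
    have h1 : fderiv ℝ (fderiv ℝ h) z u v = fderiv ℝ (fun y => fderiv ℝ h y v) z u := by
      rw [fderiv_clm_apply hd2 (differentiableAt_const v)]
      simp
    rw [h1]
    exact IsHermitianSymm.fderiv (hd2.clm_apply (differentiableAt_const v))
      (hev fun y hy => hsymm y hy v) u
  have hS := (hsmz.isSymmSndFDerivAt (by simpa using ENat.LEInfty.out)).eq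
  have htrace := double_trace_eq_zero hF hD2 (by simp) (by simp) (fun x y a b => rfl)
    (del_delbar_fundamental_apply (hev fun y hy => (hh y hy).isHermitianSymm) hsmz (hev hd)
      (hev hΩ') (fun x y a b => (fderiv ℝ (fderiv ℝ h) z x y (mulI n a) b : ℂ))
      fun x y a b => rfl)
    (hF.sum_eq_zero_of_wedge_wedgePow (hh z hz).mulI_mulI (hΩ z hz) hn (hG z hz))
  have hbal := fun w => deriv_trace_balanced hF (hd z hz) hd2 w (hev fun y hy =>
    trace_eq_of_extDeriv_hodgeStar hU hy hh (hd y hy) (hh z hz) hF hm hΩ (hB y hy) w)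
  -- The quadratic expression is the left side of `hbal` summed over `w`, which is the Gauduchon
  -- trace once the last two arguments of the second derivative are exchanged.
  have hcyc := cyclic_sum_eq_zero hF (hsymm z hz) (by
    rw [← htrace]
    refine Finset.sum_congr rfl fun w _ => ?_
    rw [← hbal w]
    refine Finset.sum_congr rfl fun p _ => ?_
    rw [(hD2 (F w) (F p)).symm])
  have hder : fderiv ℝ Ω z = (fundamentalCLM n).comp (fderiv ℝ h z) :=
    fderiv_fundamental (hd z hz) (hev hΩ')
  have key : (extDeriv Ω z).toAlternatingMap = 0 := by
    refine Module.Basis.ext_alternating F fun v _ => ?_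
    have hv : (fun i => F (v i)) = ![F (v 0), F (v 1), F (v 2)] := by
      funext i
      fin_cases i <;> rfl
    obtain ⟨h0, h1, h2⟩ := vec_three_removeNth (F (v 0)) (F (v 1)) (F (v 2))
    change extDeriv Ω z (fun i => F (v i)) = 0
    rw [hv, extDeriv, ContinuousAlternatingMap.alternatizeUncurryFin_apply, Fin.sum_univ_three,
      h0, h1, h2, hder]
    simp only [ContinuousLinearMap.comp_apply, (hsymm z hz _).fundamentalCLM_apply]
    have h3 := hcyc (v 0) (v 1) (v 2)
    rw [(hsymm z hz (F (v 1))).symm, (hsymm z hz (F (v 1))).apply_mulI] at h3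
    have h4 : (fderiv ℝ h z (F (v 0)) (mulI n (F (v 1))) (F (v 2)) : ℂ) +
        ((-fderiv ℝ h z (F (v 1)) (mulI n (F (v 0))) (F (v 2)) : ℝ) : ℂ) +
        (fderiv ℝ h z (F (v 2)) (mulI n (F (v 0))) (F (v 1)) : ℂ) = 0 := by
      exact_mod_cast h3
    simp [-mulI_apply] at h4 ⊢
    linear_combination h4
  ext v
  exact DFunLike.congr_fun key v

end HermitianGeometry

end

theorem mainTheorem2 (n : ℕ) (hn : 3 ≤ n) (M : Type*) [TopologicalSpace M] [T2Space M]
    [CompactSpace M] [ChartedSpace (HermitianGeometry.Cn n) M]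
    [IsManifold 𝓘(ℂ, HermitianGeometry.Cn n) ω M]
    (g : HermitianGeometry.HermitianMetric n M) (hG : g.IsFirstGauduchon)
    (hB : g.IsBalanced (le_trans (by norm_num) hn)) :
    g.IsKahler := by
  intro e he z hz
  have hh : ∀ y ∈ e.target, HermitianGeometry.IsHermitianForm (g.inChart e y) := fun y hy =>
    ⟨g.inChart_symm y, fun v hv => g.inChart_pos he hy hv, g.inChart_mulI he hy⟩
  refine HermitianGeometry.extDeriv_fundamental_eq_zero (by omega) e.open_target
    (g.contDiffOn_inChart he) hh (fun y hy v => g.fundamentalFormInChart_apply he hy v)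
    (m := 2 * n - 2) (by omega) (hG e he) (fun y hy => ?_) hz
  -- From `J⋆d⋆Ω = 0`, strip `J` and then the star on degree `2n - 1` to obtain `d⋆Ω = 0`.
  refine (hh y hy).eq_zero_of_hodgeStar_eq_zero (by omega) ?_
    (HermitianGeometry.covecJ_eq_zero (hB e he y hy))
  have := (hh y hy).det_gram_pos (HermitianGeometry.realBasis n)
  rwa [HermitianGeometry.coe_realBasis] at this
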